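/- **Bands.** A pointed monoid is a commutative monoid $B$ (written multiplicatively, with unit $1$) together with an element $0$ such that $0\cdot a=0$ for all $a\in B$. Its ambient semiring $B^+$ is the semiring of formal sums $\sum a_i$ of elements of $B$, where summands $0$ may be added and omitted. An ideal of $B^+$ is a subset that contains the empty sum and is closed under sums and under multiplication by elements of $B$. A *band* is a pointed monoid $B$ together with an ideal $N_B$ of $B^+$ (the null set) such that for every $a\in B$ there is a unique $-a\in B$ with $a+(-a)\in N_B$. A band morphism is a multiplicative map $f:B\to C$ with $f(0)=0$, $f(1)=1$ and $\sum f(a_i)\in N_C$ whenever $\sum a_i\in N_B$. An *idyll* is a band with $0\neq1$ in which every nonzero element is a unit. The band with one element is denoted $\mathbf 0$. A *null ideal* of $B$ is an ideal $I$ of $B^+$ that contains $N_B$ and such that $a-c\in I$ and $c+\sum b_j\in I$ imply $a+\sum b_j\in I$. The quotient $B/\!\!/I$ is the band of classes of elements of $B$ modulo $a\sim b\Leftrightarrow a-b\in I$, with null set $\{\sum[a_i]\mid\sum a_i\in I\}$. For $T\subset B^+$, $\langle T\rangle$ is the smallest null ideal that contains $T$. An *$m$-ideal* of $B$ is a subset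 $I$ with $0\in I$ and $BI\subset I$; it is *prime* if $B\setminus I$ contains $1$ and is closed under multiplication. A *$k$-ideal* is an $m$-ideal $I$ such that $a\in I$ whenever $a+\sum b_i\in N_B$ with all $b_i\in I$; a prime $k$-ideal is a $k$-ideal that is prime as an $m$-ideal. **Band schemes.** The spectrum $\operatorname{Spec}B$ is the set of prime $m$-ideals of $B$ with the topology generated by the sets $U_h=\{\mathfrak p\mid h\notin\mathfrak p\}$ for $h\in B$, together with the sheaf of bands whose sections on $U_h$ are $B[h^{-1}]$. Band spaces are topological spaces with a sheaf of bands; morphisms are continuous maps with a morphism of sheaves of bands whose induced maps on stalks send non-units to non-units. A *band scheme* is a band space that is locally isomorphic to spectra of bands. For a point $x$ of a band scheme $X$, let $\mathfrak m_x\subset\mathcal O_{X,x}$ be the set of non-units of the stalk at $x$, and let $k(x)=\mathcal O_{X,x}/\!\!/\langle\mathfrak m_x\rangle$. The *kernel space* $X^{\ker}$ of a band scheme $X$ is the topological subspace of all points $x\in X$ for which there is an affine open neighbourhood $U\cong\operatorname{Spec}B$ such that $x$ corresponds to a prime $k$-ideal of $B$. **Rational points.** The Krasner hyperfield is the band $\mathbb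 K=\{0,1\}$ with the obvious multiplication and with null set $\{0,\,1+1,\,1+1+1,\dots\}$; its natural topology has the open subsets $\emptyset$, $\{1\}$ and $\mathbb K$. For a band scheme $X$, the set $X(\mathbb K)=\operatorname{Hom}(\operatorname{Spec}\mathbb K,X)$ is endowed with the fine topology: if $X=\operatorname{Spec}C$ is affine, the affine topology on $X(\mathbb K)=\operatorname{Hom}(C,\mathbb K)$ is the compact-open topology with respect to the discrete topology on $C$ and the natural topology on $\mathbb K$; the fine topology on $X(\mathbb K)$ is the finest topology such that for every morphism $Y\to X$ from an affine band scheme $Y$ the induced map $Y(\mathbb K)\to X(\mathbb K)$ is continuous with respect to the affine topology on $Y(\mathbb K)$. The *characteristic map* $\chi:X(\mathbb K)\to X$ sends $\alpha:\operatorname{Spec}\mathbb K\to X$ to the image $\alpha(\{0\})$ of the unique point of $\operatorname{Spec}\mathbb K$. **Theorem.** Let $X$ be a band scheme. (a) The image of the characteristic map $\chi:X(\mathbb K)\to X$ is contained in $X^{\ker}$, and $\chi$ restricts to a homeomorphism $X(\mathbb K)\to X^{\ker}$. (b) For every point $x\in X$, the following are equivalent: 1. $x\in X^{\ker}$; 2.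 $\{x\}$ is the image of a morphism $Y\to X$ for some band scheme $Y$; 3. $k(x)$ is an idyll; 4. $k(x)\neq\mathbf 0$. -/

import Mathlib

open CategoryTheory TopologicalSpace Opposite

universe u v

/-! ## Bands -/

/-- Formal sums `∑ aᵢ` of elements of a pointed monoid `B` are multisets in `B`, and the ambient
semiring `B⁺` is the set of formal sums modulo adding and deleting summands `0`. A subset of `B⁺`
is encoded as a set of formal sums that is stable under adding and deleting `0`; it is an ideal
if it contains the empty sum and is closed under sums and under multiplication by `B`. -/
structure IsAmbientIdeal {B : Type u} [CommMonoidWithZero B] (I : Set (Multiset B)) : Prop where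
  zero_mem : (0 : Multiset B) ∈ I
  add_mem : ∀ {s t : Multiset B}, s ∈ I → t ∈ I → s + t ∈ I
  mul_mem : ∀ (a : B) {s : Multiset B}, s ∈ I → s.map (fun b => a * b) ∈ I
  zero_cons_mem_iff : ∀ s : Multiset B, (0 : B) ::ₘ s ∈ I ↔ s ∈ I

/-- The ideal of the ambient semiring `B⁺` that is generated by a set of formal sums. -/
def ambientSpan {B : Type u} [CommMonoidWithZero B] (T : Set (Multiset B)) : Set (Multiset B) :=
  ⋂₀ {I | IsAmbientIdeal I ∧ T ⊆ I}

theorem subset_ambientSpan {B : Type u} [CommMonoidWithZero B] (T : Set (Multiset B)) :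
    T ⊆ ambientSpan T := fun _ hs _ hI => hI.2 hs

theorem isAmbientIdeal_ambientSpan {B : Type u} [CommMonoidWithZero B] (T : Set (Multiset B)) :
    IsAmbientIdeal (ambientSpan T) where
  zero_mem := fun _ hI => hI.1.zero_mem
  add_mem := fun hs ht I hI => hI.1.add_mem (hs I hI) (ht I hI)
  mul_mem := fun a _ hs I hI => hI.1.mul_mem a (hs I hI)
  zero_cons_mem_iff := fun s => forall₂_congr fun _ hI => hI.1.zero_cons_mem_iff s

/-- A band: a commutative pointed monoid `B` with an ideal `N_B` of `B⁺`, the null set, such that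
for every `a` there is a unique `b` with `a + b ∈ N_B`. -/
class Band (B : Type u) extends CommMonoidWithZero B where
  nullSet : Set (Multiset B)
  isAmbientIdeal_nullSet : IsAmbientIdeal nullSet
  existsUnique_neg : ∀ a : B, ∃! b : B, ({a, b} : Multiset B) ∈ nullSet

namespace Band

variable {B : Type u} [Band B]

/-- The additive inverse `-a` of an element of a band. -/
noncomputable def neg (a : B) : B := (existsUnique_neg a).choose

theorem pair_neg_mem (a : B) : ({a, neg a} : Multiset B) ∈ nullSet :=
  (existsUnique_neg a).choose_spec.1

theorem eq_of_pair_mem {a b c : B} (hb : ({a, b} : Multiset B) ∈ nullSet)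
    (hc : ({a, c} : Multiset B) ∈ nullSet) : b = c :=
  (existsUnique_neg a).unique hb hc

theorem pair_neg_mul_mem (a b : B) : ({a * b, neg a * b} : Multiset B) ∈ nullSet := by
  have h := isAmbientIdeal_nullSet.mul_mem b (pair_neg_mem a)
  simpa [mul_comm b] using h

theorem neg_mul (a b : B) : neg (a * b) = neg a * b :=
  eq_of_pair_mem (pair_neg_mem (a * b)) (pair_neg_mul_mem a b)

theorem neg_neg (a : B) : neg (neg a) = a :=
  eq_of_pair_mem (pair_neg_mem (neg a)) (by rw [Multiset.pair_comm]; exact pair_neg_mem a)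

theorem neg_zero : neg (0 : B) = 0 := by
  have h := neg_mul (0 : B) 0
  simpa using h

end Band

/-- An idyll: a band with `0 ≠ 1` in which every nonzero element is a unit. -/
def IsIdyll (B : Type u) [Band B] : Prop :=
  (0 : B) ≠ 1 ∧ ∀ a : B, a ≠ 0 → IsUnit a

/-- A band morphism: a multiplicative map preserving `0`, `1` and null formal sums. -/
structure BandHom (B : Type u) (C : Type v) [Band B] [Band C] extends B →*₀ C where
  map_mem_nullSet' : ∀ s : Multiset B, s ∈ Band.nullSet → s.map toFun ∈ Band.nullSet

namespace BandHom

variable {B : Type u} {C : Type v} [Band B] [Band C]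

instance : FunLike (BandHom B C) B C where
  coe f := f.toFun
  coe_injective := by
    rintro ⟨f, hf⟩ ⟨g, hg⟩ h
    congr
    exact DFunLike.ext f g (congrFun h)

instance : MonoidWithZeroHomClass (BandHom B C) B C where
  map_mul f := f.map_mul'
  map_one f := f.map_one'
  map_zero f := f.map_zero'

@[ext] theorem ext {f g : BandHom B C} (h : ∀ a, f a = g a) : f = g := DFunLike.ext f g h

theorem map_mem_nullSet (f : BandHom B C) {s : Multiset B} (hs : s ∈ Band.nullSet) :
    s.map f ∈ Band.nullSet := f.map_mem_nullSet' s hs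

/-- The identity morphism of a band. -/
def id (B : Type u) [Band B] : BandHom B B where
  __ := MonoidWithZeroHom.id B
  map_mem_nullSet' := fun s hs => by
    have h : s.map (fun a => a) = s := Multiset.map_id' s
    exact h.symm ▸ hs

/-- The composition `g ∘ f` of band morphisms. -/
def comp {A B C : Type*} [Band A] [Band B] [Band C] (g : BandHom B C) (f : BandHom A B) :
    BandHom A C where
  __ := g.toMonoidWithZeroHom.comp f.toMonoidWithZeroHom
  map_mem_nullSet' := fun s hs => by
    have h : s.map (fun a => g (f a)) = (s.map f).map g := (Multiset.map_map g f s).symm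
    exact h.symm ▸ g.map_mem_nullSet (f.map_mem_nullSet hs)

end BandHom

/-- The category of bands. -/
structure BandCat : Type (u + 1) where
  carrier : Type u
  [band : Band carrier]

namespace BandCat

instance : CoeSort BandCat.{u} (Type u) := ⟨carrier⟩

instance (B : BandCat.{u}) : Band B := B.band

instance : Category BandCat.{u} where
  Hom A B := BandHom A B
  id A := BandHom.id A
  comp f g := BandHom.comp g f

/-- The band morphism underlying a morphism in the category of bands. -/
abbrev Hom.hom {A B : BandCat.{u}} (f : A ⟶ B) : BandHom A B := f

end BandCat

/-! ## Null ideals and quotients -/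

/-- A null ideal of a band `B`: an ideal `I` of `B⁺` that contains `N_B` and satisfies the
substitution rule: if `a - c ∈ I` and `c + ∑ bⱼ ∈ I`, then `a + ∑ bⱼ ∈ I`. -/
structure IsNullIdeal {B : Type u} [Band B] (I : Set (Multiset B)) : Prop
    extends IsAmbientIdeal I where
  nullSet_subset : Band.nullSet ⊆ I
  substitution : ∀ (a c : B) (t : Multiset B), ({a, Band.neg c} : Multiset B) ∈ I →
    c ::ₘ t ∈ I → a ::ₘ t ∈ I

/-- The null ideal `⟨T⟩` generated by a set of formal sums. -/
def nullSpan {B : Type u} [Band B] (T : Set (Multiset B)) : Set (Multiset B) :=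
  ⋂₀ {I | IsNullIdeal I ∧ T ⊆ I}

theorem isNullIdeal_nullSpan {B : Type u} [Band B] (T : Set (Multiset B)) :
    IsNullIdeal (nullSpan T) where
  zero_mem := fun _ hI => hI.1.zero_mem
  add_mem := fun hs ht I hI => hI.1.add_mem (hs I hI) (ht I hI)
  mul_mem := fun a _ hs I hI => hI.1.mul_mem a (hs I hI)
  zero_cons_mem_iff := fun s => forall₂_congr fun _ hI => hI.1.zero_cons_mem_iff s
  nullSet_subset := fun _ hs _ hI => hI.1.nullSet_subset hs
  substitution := fun a c t h h' I hI => hI.1.substitution a c t (h I hI) (h' I hI)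

namespace IsNullIdeal

variable {B : Type u} [Band B] {I : Set (Multiset B)}

/-- The congruence `a ∼ b :↔ a - b ∈ I` on `B` defined by a null ideal `I`. -/
def con (hI : IsNullIdeal I) : Con B where
  r a b := ({a, Band.neg b} : Multiset B) ∈ I
  iseqv :=
    { refl := fun a => hI.nullSet_subset (Band.pair_neg_mem a)
      symm := fun {a b} h => by
        have h1 := hI.mul_mem (Band.neg 1) h
        have h2 : ∀ c : B, Band.neg 1 * c = Band.neg c := fun c => by
          rw [← Band.neg_mul, one_mul]
        have h3 : ({a, Band.neg b} : Multiset B).map (fun c => Band.neg 1 * c)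
            = {b, Band.neg a} := by
          rw [Multiset.pair_comm b]
          simp [h2, Band.neg_neg]
        rwa [h3] at h1
      trans := fun {a b c} h h' => hI.substitution a b {Band.neg c} h h' }
  mul' := fun {a b c d} (h : ({a, Band.neg b} : Multiset B) ∈ I)
      (h' : ({c, Band.neg d} : Multiset B) ∈ I) => by
    have h1 : ({a * c, Band.neg (b * c)} : Multiset B) ∈ I := by
      have := hI.mul_mem c h
      simpa [Band.neg_mul, mul_comm c] using this
    have h2 : ({b * c, Band.neg (b * d)} : Multiset B) ∈ I := by
      have := hI.mul_mem b h'
      have e : b * Band.neg d = Band.neg (b * d) := by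
        rw [mul_comm b, mul_comm b, Band.neg_mul]
      simpa [e] using this
    exact hI.substitution _ _ {Band.neg (b * d)} h1 h2

end IsNullIdeal

/-- The quotient `B ⫽ I` of a band by a null ideal, as a set. -/
def BandQuotient {B : Type u} [Band B] {I : Set (Multiset B)} (hI : IsNullIdeal I) : Type u :=
  hI.con.Quotient

namespace BandQuotient

variable {B : Type u} [Band B] {I : Set (Multiset B)} (hI : IsNullIdeal I)

/-- The class of an element in the quotient `B ⫽ I`. -/
def mk (a : B) : BandQuotient hI := (a : hI.con.Quotient)

theorem mk_surjective : Function.Surjective (mk hI) := Quotient.mk_surjective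

theorem mk_eq_mk_iff {a b : B} : mk hI a = mk hI b ↔ ({a, Band.neg b} : Multiset B) ∈ I :=
  hI.con.eq

instance : CommMonoid (BandQuotient hI) := inferInstanceAs (CommMonoid hI.con.Quotient)

theorem mk_mul (a b : B) : mk hI (a * b) = mk hI a * mk hI b := rfl

theorem mk_one : mk hI 1 = 1 := rfl

instance : CommMonoidWithZero (BandQuotient hI) where
  zero := mk hI 0
  zero_mul := fun x => by
    obtain ⟨a, rfl⟩ := mk_surjective hI x
    exact congrArg (mk hI) (zero_mul a)
  mul_zero := fun x => by
    obtain ⟨a, rfl⟩ := mk_surjective hI x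
    exact congrArg (mk hI) (mul_zero a)

theorem mk_zero : mk hI 0 = 0 := rfl

theorem mem_of_map_mk_eq {s t : Multiset B} (hs : s ∈ I)
    (h : s.map (mk hI) = t.map (mk hI)) : t ∈ I := by
  have key : ∀ (t s r : Multiset B), s.map (mk hI) = t.map (mk hI) → s + r ∈ I → t + r ∈ I := by
    intro t
    induction t using Multiset.induction_on with
    | empty =>
      intro s r h hs
      have : s = 0 := by simpa using h
      simpa [this] using hs
    | cons b t ih =>
      intro s r h hs
      have hb : mk hI b ∈ s.map (mk hI) := by rw [h]; simp
      obtain ⟨a, ha, hab⟩ := Multiset.mem_map.1 hb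
      obtain ⟨s', rfl⟩ := Multiset.exists_cons_of_mem ha
      have h' : s'.map (mk hI) = t.map (mk hI) := by
        rw [Multiset.map_cons, Multiset.map_cons, hab] at h
        exact (Multiset.cons_inj_right _).1 h
      have h1 : b ::ₘ (s' + r) ∈ I :=
        hI.substitution b a _ ((mk_eq_mk_iff hI).1 hab.symm) (by simpa using hs)
      have h2 := ih s' (b ::ₘ r) h' (by simpa using h1)
      simpa using h2
  simpa using key t s 0 h (by simpa using hs)

/-- The quotient `B ⫽ I` is a band with null set `{∑ [aᵢ] | ∑ aᵢ ∈ I}`. -/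
instance : Band (BandQuotient hI) where
  nullSet := (fun s : Multiset B => s.map (mk hI)) '' I
  isAmbientIdeal_nullSet :=
    { zero_mem := ⟨0, hI.zero_mem, rfl⟩
      add_mem := by
        rintro _ _ ⟨s, hs, rfl⟩ ⟨t, ht, rfl⟩
        exact ⟨s + t, hI.add_mem hs ht, Multiset.map_add _ _ _⟩
      mul_mem := by
        rintro x _ ⟨s, hs, rfl⟩
        obtain ⟨a, rfl⟩ := mk_surjective hI x
        refine ⟨_, hI.mul_mem a hs, ?_⟩
        simp only [Multiset.map_map, Function.comp_def, mk_mul]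
      zero_cons_mem_iff := by
        intro m
        obtain ⟨t, rfl⟩ := Multiset.map_surjective_of_surjective (mk_surjective hI) m
        constructor
        · rintro ⟨s, hs, h⟩
          refine ⟨t, ?_, rfl⟩
          have h0 : (0 : B) ::ₘ t ∈ I := mem_of_map_mk_eq hI hs (by simpa [mk_zero] using h)
          exact (hI.zero_cons_mem_iff t).1 h0
        · rintro ⟨s, hs, h⟩
          refine ⟨0 ::ₘ s, (hI.zero_cons_mem_iff s).2 hs, ?_⟩
          have h' : s.map (mk hI) = t.map (mk hI) := h
          simp [mk_zero, h'] }
  existsUnique_neg := by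
    intro x
    obtain ⟨a, rfl⟩ := mk_surjective hI x
    refine ⟨mk hI (Band.neg a), ⟨_, hI.nullSet_subset (Band.pair_neg_mem a), by simp⟩, ?_⟩
    rintro y ⟨s, hs, h⟩
    obtain ⟨b, rfl⟩ := mk_surjective hI y
    have hab : ({a, b} : Multiset B) ∈ I := mem_of_map_mk_eq hI hs (by simpa using h)
    rw [mk_eq_mk_iff, Band.neg_neg, Multiset.pair_comm]
    exact hab

end BandQuotient

/-! ## Localizations -/

section Localization

variable {B : Type u} [Band B] (S : Submonoid B)

/-- The null set of `S⁻¹B`: the ideal generated by the sums `∑ aᵢ / 1` with `∑ aᵢ ∈ N_B`. -/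
def localizationNullSet : Set (Multiset (Localization S)) :=
  ambientSpan {m | ∃ s : Multiset B, s ∈ Band.nullSet ∧
    m = s.map (fun a => Localization.mk a (1 : S))}

variable {S}

theorem Localization.mk_one_right_eq_zero {a : B}
    (h : Localization.mk a (1 : S) = 0) : ∃ t : S, (t : B) * a = 0 := by
  rw [← Localization.mk_zero (1 : S), Localization.mk_eq_mk_iff, Localization.r_iff_exists] at h
  obtain ⟨c, hc⟩ := h
  exact ⟨c, by simpa using hc⟩

theorem mem_localizationNullSet_iff (m : Multiset (Localization S)) :
    m ∈ localizationNullSet S ↔ ∃ (t : S) (s : Multiset B), s ∈ Band.nullSet ∧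
      s.map (fun a => Localization.mk a (1 : S)) =
        m.map (fun x => Localization.mk (t : B) (1 : S) * x) := by
  have hN := Band.isAmbientIdeal_nullSet (B := B)
  have e1 : ∀ (t : B) (s : Multiset B), (s.map (fun a => t * a)).map
      (fun a => Localization.mk a (1 : S)) =
      (s.map (fun a => Localization.mk a (1 : S))).map
        (fun x => Localization.mk t (1 : S) * x) := by
    intro t s
    simp only [Multiset.map_map, Function.comp_def, Localization.mk_mul, mul_one]
  have e2 : ∀ (t t' : B) (m : Multiset (Localization S)),
      (m.map (fun x => Localization.mk t (1 : S) * x)).map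
        (fun x => Localization.mk t' (1 : S) * x) =
      m.map (fun x => Localization.mk (t' * t) (1 : S) * x) := by
    intro t t' m
    simp only [Multiset.map_map, Function.comp_def, ← mul_assoc, Localization.mk_mul, mul_one]
  constructor
  · intro hm
    refine hm {m | ∃ (t : S) (s : Multiset B), s ∈ Band.nullSet ∧
      s.map (fun a => Localization.mk a (1 : S)) =
        m.map (fun x => Localization.mk (t : B) (1 : S) * x)} ⟨⟨?_, ?_, ?_, ?_⟩, ?_⟩
    · exact ⟨1, 0, hN.zero_mem, by simp⟩
    · rintro m m' ⟨t, s, hs, h⟩ ⟨t', s', hs', h'⟩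
      refine ⟨t' * t, s.map (fun a => (t' : B) * a) + s'.map (fun a => (t : B) * a),
        hN.add_mem (hN.mul_mem _ hs) (hN.mul_mem _ hs'), ?_⟩
      rw [Multiset.map_add, Multiset.map_add, e1, e1, h, h', e2, e2, Submonoid.coe_mul,
        mul_comm (t : B)]
    · rintro x m ⟨t, s, hs, h⟩
      induction x using Localization.induction_on with
      | H y =>
        obtain ⟨a, r⟩ := y
        refine ⟨t * r, s.map (fun b => a * b), hN.mul_mem _ hs, ?_⟩
        rw [e1, h]
        simp only [Multiset.map_map, Function.comp_def, ← mul_assoc, Localization.mk_mul, mul_one,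
          one_mul]
        refine Multiset.map_congr rfl fun y _ => ?_
        congr 1
        rw [Localization.mk_eq_mk_iff, Localization.r_iff_exists]
        exact ⟨1, by simp [mul_comm, mul_left_comm]⟩
    · intro m
      constructor
      · rintro ⟨t, s, hs, h⟩
        rw [Multiset.map_cons, mul_zero] at h
        have h0 : (0 : Localization S) ∈ s.map (fun a => Localization.mk a (1 : S)) := by
          rw [h]; simp
        obtain ⟨a, ha, ha0⟩ := Multiset.mem_map.1 h0
        obtain ⟨r, hr⟩ := Localization.mk_one_right_eq_zero ha0
        obtain ⟨s', rfl⟩ := Multiset.exists_cons_of_mem ha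
        rw [Multiset.map_cons, ha0] at h
        have h' := (Multiset.cons_inj_right _).1 h
        refine ⟨r * t, s'.map (fun b => r * b), ?_, ?_⟩
        · have := hN.mul_mem (r : B) hs
          rw [Multiset.map_cons, hr] at this
          exact (hN.zero_cons_mem_iff _).1 this
        · rw [e1, h', e2, Submonoid.coe_mul]
      · rintro ⟨t, s, hs, h⟩
        exact ⟨t, 0 ::ₘ s, (hN.zero_cons_mem_iff s).2 hs, by
          rw [Multiset.map_cons, Multiset.map_cons, h, mul_zero, Localization.mk_zero]⟩
    · rintro m ⟨s, hs, rfl⟩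
      exact ⟨1, s, hs, by simp [Localization.mk_mul]⟩
  · rintro ⟨t, s, hs, h⟩
    have h1 := (isAmbientIdeal_ambientSpan _).mul_mem (Localization.mk 1 t)
      (subset_ambientSpan {m | ∃ s : Multiset B, s ∈ Band.nullSet ∧
        m = s.map (fun a => Localization.mk a (1 : S))} ⟨s, hs, rfl⟩)
    rw [h, Multiset.map_map] at h1
    have h2 : ∀ x : Localization S, Localization.mk 1 t * (Localization.mk (t : B) (1 : S) * x)
        = x := by
      intro x
      rw [← mul_assoc, Localization.mk_mul]
      simp [Localization.mk_self]
    simp only [Function.comp_def, h2, Multiset.map_id'] at h1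
    exact h1

instance : Band (Localization S) where
  nullSet := localizationNullSet S
  isAmbientIdeal_nullSet := isAmbientIdeal_ambientSpan _
  existsUnique_neg := by
    intro x
    have hun : ∀ y : Localization S, ({x, y} : Multiset (Localization S)) ∈ localizationNullSet S →
        y = Localization.mk (Band.neg 1) 1 * x := by
      intro y hy
      obtain ⟨t, s, hs, h⟩ := (mem_localizationNullSet_iff _).1 hy
      have hx : Localization.mk (t : B) (1 : S) * x ∈
          s.map (fun a => Localization.mk a (1 : S)) := by rw [h]; simp
      obtain ⟨a, ha, hax⟩ := Multiset.mem_map.1 hx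
      obtain ⟨s', rfl⟩ := Multiset.exists_cons_of_mem ha
      have h' : s'.map (fun a => Localization.mk a (1 : S)) =
          {Localization.mk (t : B) (1 : S) * y} := by
        have h2 : ({x, y} : Multiset (Localization S)).map
            (fun x => Localization.mk (t : B) (1 : S) * x) =
            (Localization.mk (t : B) (1 : S) * x) ::ₘ {Localization.mk (t : B) (1 : S) * y} := by
          simp
        rw [h2, Multiset.map_cons, hax] at h
        exact (Multiset.cons_inj_right _).1 h
      obtain ⟨c, rfl, hc⟩ := Multiset.map_eq_singleton.1 h'
      have hca : c = Band.neg 1 * a := by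
        rw [← Band.neg_mul, one_mul]
        exact Band.eq_of_pair_mem hs (Band.pair_neg_mem a)
      have hu : Localization.mk (t : B) (1 : S) * y =
          Localization.mk (t : B) (1 : S) * (Localization.mk (Band.neg 1) 1 * x) := by
        rw [mul_left_comm, ← hax, ← hc, hca, Localization.mk_mul, mul_one]
      have h3 : ∀ z : Localization S, Localization.mk 1 t * (Localization.mk (t : B) (1 : S) * z)
          = z := by
        intro z
        rw [← mul_assoc, Localization.mk_mul]
        simp [Localization.mk_self]
      rw [← h3 y, hu, h3]
    refine ⟨Localization.mk (Band.neg 1) 1 * x, ?_, hun⟩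
    have h := (isAmbientIdeal_ambientSpan _).mul_mem x
      (subset_ambientSpan {m | ∃ s : Multiset B, s ∈ Band.nullSet ∧
        m = s.map (fun a => Localization.mk a (1 : S))}
        ⟨_, Band.pair_neg_mem (1 : B), rfl⟩)
    simp only [Multiset.insert_eq_cons, Multiset.map_cons, Multiset.map_singleton,
      Localization.mk_one, one_mul, mul_comm x] at h
    exact h

end Localization

/-! ## Ideals and the prime spectrum -/

/-- A `k`-ideal of a band: it contains `0`, absorbs multiplication by `B`, and contains `a`
whenever `a + ∑ bᵢ ∈ N_B` for some `bᵢ` in it. -/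
structure IsKIdeal {B : Type u} [Band B] (I : Set B) : Prop where
  zero_mem : (0 : B) ∈ I
  mul_mem : ∀ (a : B) {b : B}, b ∈ I → a * b ∈ I
  mem_of_cons_mem : ∀ (a : B) (s : Multiset B), (∀ b ∈ s, b ∈ I) → a ::ₘ s ∈ Band.nullSet → a ∈ I

/-- A prime `m`-ideal of a band: it contains `0`, absorbs multiplication by `B`, and its complement
contains `1` and is closed under multiplication. -/
@[ext] structure PrimeMIdeal (B : Type u) [Band B] where
  carrier : Set B
  zero_mem : (0 : B) ∈ carrier
  mul_mem : ∀ (a : B) {b : B}, b ∈ carrier → a * b ∈ carrier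
  one_notMem : (1 : B) ∉ carrier
  mul_notMem : ∀ {a b : B}, a ∉ carrier → b ∉ carrier → a * b ∉ carrier

namespace PrimeMIdeal

variable {B : Type u} [Band B]

/-- The principal open subset `U_h` of the prime spectrum. -/
def principalOpen (h : B) : Set (PrimeMIdeal B) := {p | h ∉ p.carrier}

instance : TopologicalSpace (PrimeMIdeal B) :=
  TopologicalSpace.generateFrom (Set.range principalOpen)

/-- The complement of a prime `m`-ideal, as a multiplicative subset. -/
def compl (p : PrimeMIdeal B) : Submonoid B where
  carrier := p.carrierᶜ
  one_mem' := p.one_notMem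
  mul_mem' := p.mul_notMem

theorem isOpen_principalOpen (h : B) : IsOpen (principalOpen h) :=
  TopologicalSpace.isOpen_generateFrom_of_mem ⟨h, rfl⟩

theorem isTopologicalBasis_principalOpen :
    TopologicalSpace.IsTopologicalBasis (Set.range (principalOpen (B := B))) := by
  refine ⟨?_, ?_, rfl⟩
  · rintro _ ⟨g, rfl⟩ _ ⟨h, rfl⟩ p ⟨hg, hh⟩
    refine ⟨_, ⟨g * h, rfl⟩, p.mul_notMem hg hh, fun q hq => ⟨fun hg => hq ?_, fun hh => hq ?_⟩⟩
    · rw [mul_comm]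
      exact q.mul_mem h hg
    · exact q.mul_mem g hh
  · refine Set.eq_univ_of_forall fun p => ⟨_, ⟨1, rfl⟩, p.one_notMem⟩

end PrimeMIdeal

/-! ## The structure sheaf -/

/-- The sections of the structure sheaf over an open subset `U` of the spectrum of `B`: families
of elements of the localizations `B_p`, for `p ∈ U`, that are locally given by a fraction. -/
structure SpecSections (B : Type u) [Band B] (U : Opens (PrimeMIdeal B)) : Type u where
  val : ∀ p : U, Localization p.1.compl
  isLocallyFraction : ∀ p : U, ∃ V : Opens (PrimeMIdeal B), p.1 ∈ V ∧ ∃ a f : B, ∀ q : U,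
    q.1 ∈ V → ∃ hf : f ∈ q.1.compl, val q = Localization.mk a ⟨f, hf⟩

namespace SpecSections

variable {B : Type u} [Band B] {U V : Opens (PrimeMIdeal B)}

theorem ext {s t : SpecSections B U} (h : ∀ p, s.1 p = t.1 p) : s = t := by
  cases s
  cases t
  congr
  exact funext h

instance : CommMonoidWithZero (SpecSections B U) where
  mul s t := ⟨fun p => s.1 p * t.1 p, fun p => by
    obtain ⟨V, hV, a, f, h⟩ := s.2 p
    obtain ⟨W, hW, b, g, k⟩ := t.2 p
    refine ⟨V ⊓ W, ⟨hV, hW⟩, a * b, f * g, fun q hq => ?_⟩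
    obtain ⟨hf, e⟩ := h q hq.1
    obtain ⟨hg, e'⟩ := k q hq.2
    exact ⟨mul_mem hf hg, by
      rw [e, e', Localization.mk_mul]; rfl⟩⟩
  one := ⟨fun _ => 1, fun _ => ⟨⊤, trivial, 1, 1, fun _ _ => ⟨one_mem _, Localization.mk_one.symm⟩⟩⟩
  zero := ⟨fun _ => 0, fun _ => ⟨⊤, trivial, 0, 1, fun _ _ =>
    ⟨one_mem _, (Localization.mk_zero _).symm⟩⟩⟩
  mul_assoc s t r := ext fun p => mul_assoc (s.1 p) (t.1 p) (r.1 p)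
  mul_comm s t := ext fun p => mul_comm (s.1 p) (t.1 p)
  one_mul s := ext fun p => one_mul (s.1 p)
  mul_one s := ext fun p => mul_one (s.1 p)
  zero_mul s := ext fun p => zero_mul (s.1 p)
  mul_zero s := ext fun p => mul_zero (s.1 p)

/-- The evaluation of sections at a point. -/
def eval (p : U) : SpecSections B U →*₀ Localization p.1.compl where
  toFun s := s.1 p
  map_zero' := rfl
  map_one' := rfl
  map_mul' _ _ := rfl

/-- The negative of a section, taken pointwise. -/
noncomputable def neg (s : SpecSections B U) : SpecSections B U :=
  ⟨fun p => Band.neg (s.1 p), fun p => by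
    obtain ⟨V, hV, a, f, h⟩ := s.2 p
    refine ⟨V, hV, Band.neg a, f, fun q hq => ?_⟩
    obtain ⟨hf, e⟩ := h q hq
    refine ⟨hf, ?_⟩
    rw [e]
    refine Band.eq_of_pair_mem (Band.pair_neg_mem _) ?_
    have h1 : (({a, Band.neg a} : Multiset B).map
        (fun a => Localization.mk a (1 : q.1.compl))) ∈ Band.nullSet :=
      subset_ambientSpan _ ⟨_, Band.pair_neg_mem a, rfl⟩
    have h2 := Band.isAmbientIdeal_nullSet.mul_mem (Localization.mk (1 : B) ⟨f, hf⟩) h1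
    simpa [Localization.mk_mul] using h2⟩

/-- The structure sheaf takes values in bands; a formal sum of sections is null if and only if it
is null in the localization at every point. -/
instance : Band (SpecSections B U) where
  nullSet := {m | ∀ p : U, m.map (eval p) ∈ Band.nullSet}
  isAmbientIdeal_nullSet :=
    { zero_mem := fun p => by simpa using Band.isAmbientIdeal_nullSet.zero_mem
      add_mem := fun hs ht p => by
        rw [Multiset.map_add]
        exact Band.isAmbientIdeal_nullSet.add_mem (hs p) (ht p)
      mul_mem := fun a s hs p => by
        have h := Band.isAmbientIdeal_nullSet.mul_mem (eval p a) (hs p)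
        simpa [Multiset.map_map, Function.comp_def] using h
      zero_cons_mem_iff := fun s => forall_congr' fun p => by
        rw [Multiset.map_cons, map_zero]
        exact Band.isAmbientIdeal_nullSet.zero_cons_mem_iff _ }
  existsUnique_neg := fun s => by
    refine ⟨neg s, fun p => Band.pair_neg_mem (s.1 p), fun t ht => ext fun p => ?_⟩
    exact Band.eq_of_pair_mem (ht p) (Band.pair_neg_mem (s.1 p))

/-- The restriction of sections. -/
def res (h : V ≤ U) : BandHom (SpecSections B U) (SpecSections B V) where
  toFun s := ⟨fun p => s.1 ⟨p.1, h p.2⟩, fun p => by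
    obtain ⟨W, hW, a, f, k⟩ := s.2 ⟨p.1, h p.2⟩
    exact ⟨W, hW, a, f, fun q hq => k ⟨q.1, h q.2⟩ hq⟩⟩
  map_zero' := rfl
  map_one' := rfl
  map_mul' _ _ := rfl
  map_mem_nullSet' := fun s hs p => by
    have h1 := hs ⟨p.1, h p.2⟩
    exact (Multiset.map_map _ _ _).symm ▸ h1

end SpecSections

/-- The structure presheaf on the prime spectrum of a band. -/
def specPresheaf (B : BandCat.{u}) : (TopCat.of (PrimeMIdeal B)).Presheaf BandCat.{u} where
  obj U := ⟨SpecSections B U.unop⟩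
  map f := SpecSections.res f.unop.le
  map_id _ := rfl
  map_comp _ _ := rfl

theorem isSheaf_specPresheaf (B : BandCat.{u}) : (specPresheaf B).IsSheaf := by
  intro E
  rw [← isSheaf_iff_isSheaf_of_type]
  refine TopCat.Presheaf.isSheaf_of_isSheafUniqueGluing_types
    (X := TopCat.of (PrimeMIdeal B)) (specPresheaf B ⋙ coyoneda.obj (op E)) ?_
  intro ι U sf hsf
  let sf' : ∀ i, BandHom E (SpecSections B (U i)) := sf
  have hc : ∀ (i j : ι) (e : E) (p : PrimeMIdeal B) (hi : p ∈ U i) (hj : p ∈ U j),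
      (sf' i e).1 ⟨p, hi⟩ = (sf' j e).1 ⟨p, hj⟩ := by
    intro i j e p hi hj
    have h := hsf i j
    have h' : (BandHom.comp (SpecSections.res (inf_le_left : U i ⊓ U j ≤ U i)) (sf' i)) =
      (BandHom.comp (SpecSections.res (inf_le_right : U i ⊓ U j ≤ U j)) (sf' j)) := h
    have h2 := congrArg (fun s : SpecSections B (U i ⊓ U j) => s.1 ⟨p, hi, hj⟩)
      (DFunLike.congr_fun h' e)
    exact h2
  have hmem : ∀ p : (iSup U : Opens (PrimeMIdeal B)), ∃ i, p.1 ∈ U i := fun p =>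
    Opens.mem_iSup.1 p.2
  choose idx hidx using hmem
  let g : BandHom E (SpecSections B (iSup U)) :=
    { toFun := fun e => ⟨fun p => (sf' (idx p) e).1 ⟨p.1, hidx p⟩, fun p => by
        obtain ⟨W, hW, a, f, k⟩ := (sf' (idx p) e).2 ⟨p.1, hidx p⟩
        refine ⟨W ⊓ U (idx p), ⟨hW, hidx p⟩, a, f, fun q hq => ?_⟩
        obtain ⟨hf, e'⟩ := k ⟨q.1, hq.2⟩ hq.1
        exact ⟨hf, by rw [← e']; exact hc _ _ _ _ _ _⟩⟩
      map_zero' := SpecSections.ext fun p => by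
        change (sf' (idx p) 0).1 ⟨p.1, hidx p⟩ = 0
        rw [map_zero]; rfl
      map_one' := SpecSections.ext fun p => by
        change (sf' (idx p) 1).1 ⟨p.1, hidx p⟩ = 1
        rw [map_one]; rfl
      map_mul' := fun a b => SpecSections.ext fun p => by
        change (sf' (idx p) (a * b)).1 ⟨p.1, hidx p⟩ =
          (sf' (idx p) a).1 ⟨p.1, hidx p⟩ * (sf' (idx p) b).1 ⟨p.1, hidx p⟩
        rw [map_mul]; rfl
      map_mem_nullSet' := fun s hs p => by
        have h1 := (sf' (idx p)).map_mem_nullSet hs ⟨p.1, hidx p⟩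
        rw [Multiset.map_map] at h1
        exact (Multiset.map_map _ _ _).symm ▸ h1 }
  refine ⟨g, fun i => ?_, fun g' hg' => ?_⟩
  · change BandHom.comp (SpecSections.res (le_iSup U i)) g = sf' i
    refine BandHom.ext fun e => SpecSections.ext fun p => ?_
    exact hc (idx ⟨p.1, le_iSup U i p.2⟩) i e p.1 (hidx _) p.2
  · let g'' : BandHom E (SpecSections B (iSup U)) := g'
    change g'' = g
    refine BandHom.ext fun e => SpecSections.ext fun p => ?_
    have h1 : BandHom.comp (SpecSections.res (le_iSup U (idx p))) g'' = sf' (idx p) :=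
      hg' (idx p)
    have h2 := congrArg (fun s : SpecSections B (U (idx p)) => s.1 ⟨p.1, hidx p⟩)
      (DFunLike.congr_fun h1 e)
    exact h2

/-- The canonical morphism from `B` to the global sections of the structure sheaf. -/
def toGlobalSections (B : Type u) [Band B] : BandHom B (SpecSections B ⊤) where
  toFun b := ⟨fun _ => Localization.mk b 1, fun _ => ⟨⊤, trivial, b, 1, fun _ _ =>
    ⟨one_mem _, rfl⟩⟩⟩
  map_zero' := SpecSections.ext fun _ => Localization.mk_zero _
  map_one' := SpecSections.ext fun _ => Localization.mk_one
  map_mul' a b := SpecSections.ext fun p => by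
    have h := Localization.mk_mul a b (1 : p.1.compl) 1
    rw [mul_one] at h
    exact h.symm
  map_mem_nullSet' := fun s hs p => by
    have h : s.map (fun a => Localization.mk a (1 : p.1.compl)) ∈ Band.nullSet :=
      subset_ambientSpan _ ⟨s, hs, rfl⟩
    exact (Multiset.map_map _ _ _).symm ▸ h

/-- The maximal `m`-ideal of a nonzero band, the set of its non-units. -/
def maximalMIdeal (B : Type u) [Band B] (h0 : ¬ IsUnit (0 : B)) : PrimeMIdeal B where
  carrier := {a | ¬ IsUnit a}
  zero_mem := h0
  mul_mem := fun _ _ hb hab => hb (isUnit_of_mul_isUnit_right hab)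
  one_notMem := fun h => h isUnit_one
  mul_notMem := fun ha hb h => h ((not_not.1 ha).mul (not_not.1 hb))

theorem toGlobalSections_bijective (B : Type u) [Band B] :
    Function.Bijective (toGlobalSections B) := by
  by_cases h0 : IsUnit (0 : B)
  · have h01 : ∀ a b : B, a = b := by
      intro a b
      obtain ⟨c, hc⟩ := h0.exists_left_inv
      rw [← mul_one a, ← mul_one b, ← hc, mul_zero, mul_zero, mul_zero]
    refine ⟨fun a b _ => h01 a b, fun s => ⟨0, SpecSections.ext fun p => ?_⟩⟩
    exact absurd (h01 0 1 ▸ p.1.zero_mem) p.1.one_notMem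
  · let m : (⊤ : Opens (PrimeMIdeal B)) := ⟨maximalMIdeal B h0, trivial⟩
    constructor
    · intro a b hab
      have h1 : Localization.mk a (1 : m.1.compl) = Localization.mk b 1 :=
        congrFun (congrArg SpecSections.val hab) m
      rw [Localization.mk_eq_mk_iff, Localization.r_iff_exists] at h1
      obtain ⟨c, hc⟩ := h1
      have hu : IsUnit (c : B) := not_not.1 c.2
      exact hu.mul_left_cancel (by simpa using hc)
    · intro s
      obtain ⟨V, hV, a, f, h⟩ := s.2 m
      obtain ⟨_, ⟨g, rfl⟩, hg, hgV⟩ :=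
        PrimeMIdeal.isTopologicalBasis_principalOpen.exists_subset_of_mem_open hV V.2
      have hgu : IsUnit g := not_not.1 hg
      obtain ⟨g', hg'⟩ := hgu.exists_left_inv
      have hVtop : ∀ q : PrimeMIdeal B, q ∈ V := fun q =>
        hgV fun hq => q.one_notMem (hg' ▸ q.mul_mem g' hq)
      obtain ⟨hf, -⟩ := h m hV
      obtain ⟨f', hf'⟩ := (not_not.1 hf : IsUnit f).exists_left_inv
      refine ⟨f' * a, SpecSections.ext fun q => ?_⟩
      obtain ⟨hfq, e⟩ := h q (hVtop q.1)
      rw [e]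
      change Localization.mk (f' * a) 1 = _
      rw [Localization.mk_eq_mk_iff, Localization.r_iff_exists]
      refine ⟨1, ?_⟩
      change 1 * (f * (f' * a)) = 1 * (1 * a)
      rw [← mul_assoc f, mul_comm f, hf', one_mul]

/-- The identification of `B` with the global sections of its spectrum. -/
noncomputable def globalSectionsEquiv (B : Type u) [Band B] : B ≃ SpecSections B ⊤ :=
  Equiv.ofBijective _ (toGlobalSections_bijective B)

/-! ## Stalks -/

section Stalk

variable {X : TopCat.{u}}

/-- The restriction maps of a presheaf of bands, as band morphisms. -/
def BandStalk.res (F : X.Presheaf BandCat.{u}) {U V : Opens X} (h : V ≤ U) :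
    BandHom (F.obj (op U)) (F.obj (op V)) := F.map (homOfLE h).op

theorem BandStalk.res_self (F : X.Presheaf BandCat.{u}) {U : Opens X} (s : F.obj (op U)) :
    BandStalk.res F (le_refl U) s = s :=
  DFunLike.congr_fun (F := BandHom _ _) (F.map_id (op U)) s

theorem BandStalk.res_res {F : X.Presheaf BandCat.{u}} {U V W : Opens X} (h : V ≤ U) (h' : W ≤ V)
    (s : F.obj (op U)) :
    BandStalk.res F h' (BandStalk.res F h s) = BandStalk.res F (h'.trans h) s :=
  (DFunLike.congr_fun (F := BandHom _ _) (F.map_comp (homOfLE h).op (homOfLE h').op) s).symm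

/-- A section over an open neighbourhood of `x`. -/
structure BandStalk.Rep (F : X.Presheaf BandCat.{u}) (x : X) : Type u where
  nhd : Opens X
  mem : x ∈ nhd
  sec : F.obj (op nhd)

/-- Two sections over open neighbourhoods of `x` have the same germ if they agree on a smaller open
neighbourhood of `x`. -/
instance BandStalk.setoid (F : X.Presheaf BandCat.{u}) (x : X) : Setoid (BandStalk.Rep F x) where
  r s t := ∃ (W : Opens X) (_ : x ∈ W) (hs : W ≤ s.nhd) (ht : W ≤ t.nhd),
    BandStalk.res F hs s.sec = BandStalk.res F ht t.sec
  iseqv :=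
    { refl := fun s => ⟨s.nhd, s.mem, le_rfl, le_rfl, rfl⟩
      symm := fun ⟨W, hW, hs, ht, e⟩ => ⟨W, hW, ht, hs, e.symm⟩
      trans := fun {r s t} ⟨W, hW, hr, hs, e⟩ ⟨W', hW', hs', ht, e'⟩ =>
        ⟨W ⊓ W', ⟨hW, hW'⟩, inf_le_left.trans hr, inf_le_right.trans ht, by
          rw [← BandStalk.res_res hr inf_le_left, e, BandStalk.res_res,
            ← BandStalk.res_res ht inf_le_right, ← e', BandStalk.res_res]⟩ }

/-- The stalk `colim_{x ∈ U} F(U)` of a presheaf of bands at a point. -/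
def BandStalk (F : X.Presheaf BandCat.{u}) (x : X) : Type u := Quotient (BandStalk.setoid F x)

namespace BandStalk

variable {F : X.Presheaf BandCat.{u}} {x : X}

/-- The class of a section over an open neighbourhood of `x` in the stalk. -/
def mk (s : Rep F x) : BandStalk F x := Quotient.mk _ s

theorem mk_surjective : Function.Surjective (mk (F := F) (x := x)) := Quotient.mk_surjective

/-- The product of two sections on the intersection of their domains. -/
def Rep.mul (s t : Rep F x) : Rep F x :=
  ⟨s.nhd ⊓ t.nhd, ⟨s.mem, t.mem⟩, res F inf_le_left s.sec * res F inf_le_right t.sec⟩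

theorem Rep.mul_congr {s s' t t' : Rep F x} (h : s ≈ s') (k : t ≈ t') : s.mul t ≈ s'.mul t' := by
  obtain ⟨W, hW, h1, h2, e⟩ := h
  obtain ⟨V, hV, k1, k2, e'⟩ := k
  have a1 : W ⊓ V ≤ s.nhd ⊓ t.nhd := inf_le_inf h1 k1
  have a2 : W ⊓ V ≤ s'.nhd ⊓ t'.nhd := inf_le_inf h2 k2
  refine ⟨W ⊓ V, ⟨hW, hV⟩, a1, a2, ?_⟩
  change res F a1 (_ * _) = res F a2 (_ * _)
  rw [map_mul, map_mul, res_res, res_res, res_res, res_res, ← res_res h1 inf_le_left, e, res_res,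
    ← res_res k1 inf_le_right, e', res_res]

instance : Mul (BandStalk F x) where
  mul := Quotient.map₂ Rep.mul fun _ _ h _ _ k => Rep.mul_congr h k

instance : One (BandStalk F x) := ⟨mk ⟨⊤, trivial, 1⟩⟩

instance : Zero (BandStalk F x) := ⟨mk ⟨⊤, trivial, 0⟩⟩

theorem mk_eq_mk_iff {U V : Opens X} {hU : x ∈ U} {hV : x ∈ V} {s : F.obj (op U)}
    {t : F.obj (op V)} : mk ⟨U, hU, s⟩ = mk ⟨V, hV, t⟩ ↔
      ∃ (W : Opens X) (_ : x ∈ W) (hWU : W ≤ U) (hWV : W ≤ V), res F hWU s = res F hWV t :=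
  Quotient.eq (r := setoid F x)

theorem mk_res {U V : Opens X} (h : V ≤ U) (hx : x ∈ V) (s : F.obj (op U)) :
    mk ⟨V, hx, res F h s⟩ = mk ⟨U, h hx, s⟩ :=
  mk_eq_mk_iff.2 ⟨V, hx, le_rfl, h, res_self F _⟩

theorem mk_mul_mk {U : Opens X} (hU : x ∈ U) (s t : F.obj (op U)) :
    mk ⟨U, hU, s⟩ * mk ⟨U, hU, t⟩ = mk ⟨U, hU, s * t⟩ :=
  mk_eq_mk_iff.2 ⟨U, hU, le_inf le_rfl le_rfl, le_rfl, by
    rw [map_mul, map_mul, res_res, res_res]⟩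

theorem one_eq {U : Opens X} (hU : x ∈ U) : (1 : BandStalk F x) = mk ⟨U, hU, 1⟩ :=
  mk_eq_mk_iff.2 ⟨U, hU, le_top, le_rfl, by rw [map_one, map_one]⟩

theorem zero_eq {U : Opens X} (hU : x ∈ U) : (0 : BandStalk F x) = mk ⟨U, hU, 0⟩ :=
  mk_eq_mk_iff.2 ⟨U, hU, le_top, le_rfl, by rw [map_zero, map_zero]⟩

theorem exists_mk_eq₂ (a b : BandStalk F x) : ∃ (U : Opens X) (hU : x ∈ U) (s t : F.obj (op U)),
    mk ⟨U, hU, s⟩ = a ∧ mk ⟨U, hU, t⟩ = b := by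
  obtain ⟨⟨U, hU, s⟩, rfl⟩ := mk_surjective a
  obtain ⟨⟨V, hV, t⟩, rfl⟩ := mk_surjective b
  have hW : x ∈ U ⊓ V := ⟨hU, hV⟩
  exact ⟨U ⊓ V, hW, res F inf_le_left s, res F inf_le_right t, mk_res _ hW _, mk_res _ hW _⟩

instance : CommMonoidWithZero (BandStalk F x) where
  mul_assoc a b c := by
    obtain ⟨U, hU, s, t, rfl, rfl⟩ := exists_mk_eq₂ a b
    obtain ⟨⟨V, hV, r⟩, rfl⟩ := mk_surjective c
    have hW : x ∈ U ⊓ V := ⟨hU, hV⟩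
    simp only [← mk_res (inf_le_left : U ⊓ V ≤ U) hW, ← mk_res (inf_le_right : U ⊓ V ≤ V) hW,
      mk_mul_mk, mul_assoc]
  mul_comm a b := by
    obtain ⟨U, hU, s, t, rfl, rfl⟩ := exists_mk_eq₂ a b
    rw [mk_mul_mk, mk_mul_mk, mul_comm]
  one_mul a := by
    obtain ⟨⟨U, hU, s⟩, rfl⟩ := mk_surjective a
    rw [one_eq hU, mk_mul_mk, one_mul]
  mul_one a := by
    obtain ⟨⟨U, hU, s⟩, rfl⟩ := mk_surjective a
    rw [one_eq hU, mk_mul_mk, mul_one]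
  zero_mul a := by
    obtain ⟨⟨U, hU, s⟩, rfl⟩ := mk_surjective a
    rw [zero_eq hU, mk_mul_mk, zero_mul]
  mul_zero a := by
    obtain ⟨⟨U, hU, s⟩, rfl⟩ := mk_surjective a
    rw [zero_eq hU, mk_mul_mk, mul_zero]

/-- The germ at `x` of a section over an open neighbourhood `U` of `x`. -/
def germ (F : X.Presheaf BandCat.{u}) (x : X) (U : Opens X) (hx : x ∈ U) :
    F.obj (op U) →*₀ BandStalk F x where
  toFun s := mk ⟨U, hx, s⟩
  map_zero' := (zero_eq hx).symm
  map_one' := (one_eq hx).symm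
  map_mul' s t := (mk_mul_mk hx s t).symm

theorem germ_res {U V : Opens X} (h : V ≤ U) (hx : x ∈ V) (s : F.obj (op U)) :
    germ F x V hx (res F h s) = germ F x U (h hx) s := mk_res h hx s

theorem germ_eq_iff {U V : Opens X} (hU : x ∈ U) (hV : x ∈ V) (s : F.obj (op U))
    (t : F.obj (op V)) : germ F x U hU s = germ F x V hV t ↔
      ∃ (W : Opens X) (_ : x ∈ W) (hWU : W ≤ U) (hWV : W ≤ V), res F hWU s = res F hWV t :=
  mk_eq_mk_iff

theorem exists_germ_eq (a : BandStalk F x) :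
    ∃ (U : Opens X) (hx : x ∈ U) (s : F.obj (op U)), germ F x U hx s = a := by
  obtain ⟨⟨U, hU, s⟩, rfl⟩ := mk_surjective a
  exact ⟨U, hU, s, rfl⟩

theorem map_germ_res {U V : Opens X} (h : V ≤ U) (hx : x ∈ V) (s : Multiset (F.obj (op U))) :
    (s.map (res F h)).map (germ F x V hx) =
      s.map (germ F x U (h hx)) := by
  rw [Multiset.map_map]
  exact Multiset.map_congr rfl fun a _ => germ_res h hx a

theorem exists_map_germ_eq (m : Multiset (BandStalk F x)) :
    ∃ (U : Opens X) (hx : x ∈ U) (s : Multiset (F.obj (op U))), s.map (germ F x U hx) = m := by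
  induction m using Multiset.induction_on with
  | empty => exact ⟨⊤, trivial, 0, rfl⟩
  | cons a m ih =>
    obtain ⟨U, hU, s, rfl⟩ := ih
    obtain ⟨V, hV, t, rfl⟩ := exists_germ_eq a
    have hUV : x ∈ U ⊓ V := ⟨hU, hV⟩
    refine ⟨U ⊓ V, hUV, (res F inf_le_right t) ::ₘ (s.map (res F inf_le_left)), ?_⟩
    rw [Multiset.map_cons, map_germ_res, germ_res]

theorem map_res_res {U V W : Opens X} (h : V ≤ U) (h' : W ≤ V) (s : Multiset (F.obj (op U))) :
    (s.map (res F h)).map (res F h') =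
      s.map (res F (h'.trans h)) := by
  rw [Multiset.map_map]
  exact Multiset.map_congr rfl fun a _ => res_res h h' a

theorem exists_map_res_eq {U : Opens X} (hx : x ∈ U) (s t : Multiset (F.obj (op U)))
    (h : s.map (germ F x U hx) = t.map (germ F x U hx)) :
    ∃ (W : Opens X) (_ : x ∈ W) (hWU : W ≤ U), s.map (res F hWU) =
      t.map (res F hWU) := by
  induction t using Multiset.induction_on generalizing s with
  | empty =>
    have : s = 0 := by simpa using h
    exact ⟨U, hx, le_rfl, by rw [this]⟩
  | cons b t ih =>
    have hb : germ F x U hx b ∈ s.map (germ F x U hx) := by rw [h]; simp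
    obtain ⟨a, ha, hab⟩ := Multiset.mem_map.1 hb
    obtain ⟨s', rfl⟩ := Multiset.exists_cons_of_mem ha
    rw [Multiset.map_cons, Multiset.map_cons, hab] at h
    obtain ⟨W, hW, hWU, e⟩ := ih s' ((Multiset.cons_inj_right _).1 h)
    obtain ⟨W', hW', h1, h2, e'⟩ := (germ_eq_iff hx hx a b).1 hab
    refine ⟨W ⊓ W', ⟨hW, hW'⟩, inf_le_left.trans hWU, ?_⟩
    rw [Multiset.map_cons, Multiset.map_cons]
    congr 1
    · rw [← res_res h1 (inf_le_right : W ⊓ W' ≤ W'), e', res_res]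
    · rw [← map_res_res hWU inf_le_left, e, map_res_res]

theorem exists_null_of_map_germ_eq {U V : Opens X} (hU : x ∈ U) (hV : x ∈ V)
    {s : Multiset (F.obj (op U))} (hs : s ∈ Band.nullSet) (t : Multiset (F.obj (op V)))
    (h : s.map (germ F x U hU) = t.map (germ F x V hV)) :
    ∃ (W : Opens X) (_ : x ∈ W) (hWV : W ≤ V),
      t.map (res F hWV) ∈ Band.nullSet := by
  have hUV : x ∈ U ⊓ V := ⟨hU, hV⟩
  rw [← map_germ_res (inf_le_left : U ⊓ V ≤ U) hUV, ← map_germ_res (inf_le_right : U ⊓ V ≤ V) hUV]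
    at h
  obtain ⟨W, hW, hWU, e⟩ := exists_map_res_eq hUV _ _ h
  refine ⟨W, hW, hWU.trans inf_le_right, ?_⟩
  rw [map_res_res, map_res_res] at e
  rw [← e]
  exact BandHom.map_mem_nullSet _ hs

/-- The stalk is a band: a formal sum of germs is null if it is represented by a null formal sum of
sections over some open neighbourhood. -/
instance : Band (BandStalk F x) where
  nullSet := {m | ∃ (U : Opens X) (hx : x ∈ U) (s : Multiset (F.obj (op U))),
    s ∈ Band.nullSet ∧ s.map (germ F x U hx) = m}
  isAmbientIdeal_nullSet :=
    { zero_mem := ⟨⊤, trivial, 0, Band.isAmbientIdeal_nullSet.zero_mem, rfl⟩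
      add_mem := by
        rintro _ _ ⟨U, hU, s, hs, rfl⟩ ⟨V, hV, t, ht, rfl⟩
        have hUV : x ∈ U ⊓ V := ⟨hU, hV⟩
        refine ⟨U ⊓ V, hUV, _, Band.isAmbientIdeal_nullSet.add_mem
          (BandHom.map_mem_nullSet (res F inf_le_left) hs)
          (BandHom.map_mem_nullSet (res F inf_le_right) ht), ?_⟩
        rw [Multiset.map_add, map_germ_res, map_germ_res]
      mul_mem := by
        rintro a _ ⟨U, hU, s, hs, rfl⟩
        obtain ⟨V, hV, b, rfl⟩ := exists_germ_eq a
        have hUV : x ∈ U ⊓ V := ⟨hU, hV⟩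
        refine ⟨U ⊓ V, hUV, _, Band.isAmbientIdeal_nullSet.mul_mem
          (res F inf_le_right b)
          (BandHom.map_mem_nullSet (res F inf_le_left) hs), ?_⟩
        simp only [Multiset.map_map, Function.comp_def, map_mul]
        exact Multiset.map_congr rfl fun c _ => congrArg₂ _ (germ_res _ _ _) (germ_res _ _ _)
      zero_cons_mem_iff := by
        intro m
        obtain ⟨V, hV, t, rfl⟩ := exists_map_germ_eq m
        constructor
        · rintro ⟨U, hU, s, hs, h⟩
          obtain ⟨W, hW, hWV, h0⟩ := exists_null_of_map_germ_eq hU hV hs (0 ::ₘ t)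
            (by rw [h, Multiset.map_cons, map_zero])
          rw [Multiset.map_cons, map_zero] at h0
          exact ⟨W, hW, _, (Band.isAmbientIdeal_nullSet.zero_cons_mem_iff _).1 h0,
            map_germ_res _ _ _⟩
        · rintro ⟨U, hU, s, hs, h⟩
          exact ⟨U, hU, 0 ::ₘ s, (Band.isAmbientIdeal_nullSet.zero_cons_mem_iff _).2 hs, by
            rw [Multiset.map_cons, map_zero, h]⟩ }
  existsUnique_neg := by
    intro a
    obtain ⟨V, hV, t, rfl⟩ := exists_germ_eq a
    refine ⟨germ F x V hV (Band.neg t), ⟨V, hV, _, Band.pair_neg_mem t, by simp⟩, ?_⟩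
    rintro b ⟨U, hU, s, hs, h⟩
    obtain ⟨V', hV', r, rfl⟩ := exists_germ_eq b
    have hVV : x ∈ V ⊓ V' := ⟨hV, hV'⟩
    obtain ⟨W, hW, hWV, h0⟩ := exists_null_of_map_germ_eq hU hVV hs
      {res F inf_le_left t,
        res F inf_le_right r}
      (by rw [h, Multiset.insert_eq_cons, Multiset.insert_eq_cons, Multiset.map_cons,
        Multiset.map_singleton, germ_res, germ_res])
    rw [Multiset.insert_eq_cons, Multiset.map_cons, Multiset.map_singleton, res_res, res_res] at h0
    have h1 := BandHom.map_mem_nullSet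
      (res F (hWV.trans inf_le_left : W ≤ V)) (Band.pair_neg_mem t)
    rw [Multiset.insert_eq_cons, Multiset.map_cons, Multiset.map_singleton] at h1
    have e := Band.eq_of_pair_mem h0 h1
    exact (germ_eq_iff _ _ _ _).2 ⟨W, hW, _, _, e⟩

end BandStalk

end Stalk

/-! ## Band spaces and band schemes -/

/-- A band space: a topological space together with a sheaf of bands. -/
structure BandSpace : Type (u + 1) where
  toSheafedSpace : AlgebraicGeometry.SheafedSpace.{u + 1, u, u} BandCat.{u}

namespace BandSpace

instance : CoeSort BandSpace.{u} (Type u) := ⟨fun X => X.toSheafedSpace.carrier⟩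

instance (X : BandSpace.{u}) : TopologicalSpace X := X.toSheafedSpace.carrier.str

/-- The structure sheaf of a band space. -/
abbrev presheaf (X : BandSpace.{u}) : X.toSheafedSpace.carrier.Presheaf BandCat.{u} :=
  X.toSheafedSpace.presheaf

/-- The stalk `𝒪_{X,x}` of a band space. -/
abbrev stalk (X : BandSpace.{u}) (x : X) : Type u := BandStalk X.presheaf x

end BandSpace

section StalkMap

variable {X Y : AlgebraicGeometry.SheafedSpace.{u + 1, u, u} BandCat.{u}}

/-- The pull back of sections of `Y` over `U` along a morphism `f : X ⟶ Y`. -/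
def pullbackSections (f : X ⟶ Y) (U : Opens Y.carrier) :
    BandHom (Y.presheaf.obj (op U)) (X.presheaf.obj (op ((Opens.map f.hom.base).obj U))) :=
  f.hom.c.app (op U)

theorem pullbackSections_res (f : X ⟶ Y) {U V : Opens Y.carrier} (h : V ≤ U)
    (h' : (Opens.map f.hom.base).obj V ≤ (Opens.map f.hom.base).obj U)
    (s : Y.presheaf.obj (op U)) :
    pullbackSections f V (BandStalk.res Y.presheaf h s) =
      BandStalk.res X.presheaf h' (pullbackSections f U s) :=
  DFunLike.congr_fun (F := BandHom _ _) (f.hom.c.naturality (homOfLE h).op) s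

/-- The map `𝒪_{Y,f(x)} → 𝒪_{X,x}` of stalks that is induced by a morphism `f : X ⟶ Y`. -/
def stalkMap (f : X ⟶ Y) (x : X.carrier) :
    BandHom (BandStalk Y.presheaf (f.hom.base x)) (BandStalk X.presheaf x) where
  toFun := Quotient.lift
    (fun s => BandStalk.germ X.presheaf x ((Opens.map f.hom.base).obj s.nhd) s.mem
      (pullbackSections f s.nhd s.sec)) (by
    rintro ⟨U, hU, s⟩ ⟨V, hV, t⟩ ⟨W, hW, hs, ht, e⟩
    have hs' : (Opens.map f.hom.base).obj W ≤ (Opens.map f.hom.base).obj U := fun _ h => hs h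
    have ht' : (Opens.map f.hom.base).obj W ≤ (Opens.map f.hom.base).obj V := fun _ h => ht h
    have hW' : x ∈ (Opens.map f.hom.base).obj W := hW
    refine (BandStalk.germ_eq_iff _ _ _ _).2 ⟨_, hW', hs', ht', ?_⟩
    rw [← pullbackSections_res f hs, ← pullbackSections_res f ht]
    exact congrArg _ e)
  map_zero' := map_zero (BandStalk.germ X.presheaf x _ _) ▸
    congrArg (BandStalk.germ X.presheaf x _ _) (map_zero (pullbackSections f ⊤))
  map_one' := map_one (BandStalk.germ X.presheaf x _ _) ▸
    congrArg (BandStalk.germ X.presheaf x _ _) (map_one (pullbackSections f ⊤))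
  map_mul' a b := by
    obtain ⟨U, hU, s, t, rfl, rfl⟩ := BandStalk.exists_mk_eq₂ a b
    rw [BandStalk.mk_mul_mk]
    change BandStalk.germ X.presheaf x _ _ (pullbackSections f U (s * t)) =
      BandStalk.germ X.presheaf x ((Opens.map f.hom.base).obj U) hU (pullbackSections f U s) *
      BandStalk.germ X.presheaf x ((Opens.map f.hom.base).obj U) hU (pullbackSections f U t)
    rw [map_mul, map_mul]
  map_mem_nullSet' := by
    rintro _ ⟨U, hU, s, hs, rfl⟩
    refine ⟨(Opens.map f.hom.base).obj U, hU, _,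
      (pullbackSections f U).map_mem_nullSet hs, ?_⟩
    refine (Multiset.map_map _ _ _).trans (Eq.trans ?_
      (Multiset.map_map _ (BandStalk.germ Y.presheaf (f.hom.base x) U hU) s).symm)
    rfl

theorem stalkMap_germ (f : X ⟶ Y) (x : X.carrier) (U : Opens Y.carrier) (hU : f.hom.base x ∈ U)
    (s : Y.presheaf.obj (op U)) :
    stalkMap f x (BandStalk.germ Y.presheaf _ U hU s) =
      BandStalk.germ X.presheaf x ((Opens.map f.hom.base).obj U) hU (pullbackSections f U s) :=
  rfl

end StalkMap

namespace BandSpace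

/-- A morphism of band spaces: a continuous map together with a morphism of sheaves of bands such
that the induced maps on stalks send non-units to non-units. -/
@[ext] structure Hom (X Y : BandSpace.{u}) : Type u where
  toHom : X.toSheafedSpace ⟶ Y.toSheafedSpace
  isLocal : ∀ (x : X) (a : BandStalk Y.presheaf (toHom.hom.base x)),
    ¬ IsUnit a → ¬ IsUnit (stalkMap toHom x a)

instance : Category BandSpace.{u} where
  Hom := Hom
  id X := ⟨𝟙 X.toSheafedSpace, fun x a ha h => ha (by
    obtain ⟨U, hU, s, rfl⟩ := BandStalk.exists_germ_eq a
    exact h)⟩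
  comp {X Y Z} f g := ⟨f.toHom ≫ g.toHom, fun x a ha h => by
    refine f.isLocal x _ (g.isLocal (f.toHom.hom.base x) a ha) ?_
    obtain ⟨U, hU, s, rfl⟩ := BandStalk.exists_germ_eq a
    exact h⟩

/-- The map of underlying topological spaces of a morphism of band spaces. -/
def Hom.toFun {X Y : BandSpace.{u}} (f : X ⟶ Y) : X → Y :=
  fun x => (f : Hom X Y).toHom.hom.base x

/-- The open subspace of a band space on an open subset `U`, with the restricted sheaf. -/
def restrict (X : BandSpace.{u}) (U : Opens X) : BandSpace.{u} where
  toSheafedSpace := X.toSheafedSpace.restrict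
    (U := TopCat.of U) (f := TopCat.ofHom ⟨Subtype.val, continuous_subtype_val⟩)
    U.isOpen.isOpenEmbedding_subtypeVal

end BandSpace

/-- The prime spectrum of a band, as a band space. -/
def BandSpec (B : BandCat.{u}) : BandSpace.{u} where
  toSheafedSpace :=
    { carrier := TopCat.of (PrimeMIdeal B)
      presheaf := specPresheaf B
      IsSheaf := isSheaf_specPresheaf B }

/-- A band scheme: a band space in which every point has an open neighbourhood that is isomorphic
to the spectrum of a band. Morphisms of band schemes are morphisms of band spaces. -/
structure BandScheme : Type (u + 1) extends BandSpace.{u} where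
  exists_affine : ∀ x : toBandSpace, ∃ (U : Opens toBandSpace) (_ : x ∈ U) (B : BandCat.{u}),
    Nonempty (toBandSpace.restrict U ≅ BandSpec B)

namespace BandScheme

instance : CoeSort BandScheme.{u} (Type u) := ⟨fun X => X.toBandSpace⟩

end BandScheme

/-! ## Residue fields and the kernel space -/

namespace BandSpace

/-- The maximal `m`-ideal of the stalk `𝒪_{X,x}`, the set of its non-units. -/
def maximalIdeal (X : BandSpace.{u}) (x : X) : Set (X.stalk x) := {a | ¬ IsUnit a}

/-- The residue field `k(x) = 𝒪_{X,x} ⫽ ⟨𝔪_x⟩`, where the elements of `𝔪_x` are considered as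
formal sums with one summand. -/
abbrev residueField (X : BandSpace.{u}) (x : X) : Type u :=
  BandQuotient (isNullIdeal_nullSpan
    ((fun a : X.stalk x => ({a} : Multiset (X.stalk x))) '' X.maximalIdeal x))

/-- The kernel space of a band scheme: the subspace of all points `x` that correspond, in an affine
open neighbourhood `U ≅ Spec B` of `x`, to a prime `k`-ideal of `B`. -/
def kernelSpace (X : BandSpace.{u}) : Set X :=
  {x | ∃ (U : Opens X) (hx : x ∈ U) (B : BandCat.{u}) (e : X.restrict U ≅ BandSpec B),
    IsKIdeal (Hom.toFun e.hom ⟨x, hx⟩ : PrimeMIdeal B).carrier}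

end BandSpace

/-! ## Rational points and the fine topology -/

/-- The set `X(B) = Hom(Spec B, X)` of `B`-rational points. -/
def RationalPoints (B : BandCat.{u}) (X : BandSpace.{u}) : Type u := BandSpec B ⟶ X

/-- The band morphism `C → B` on global sections of a morphism `Spec B ⟶ Spec C`. -/
noncomputable def RationalPoints.globalMap {B C : BandCat.{u}}
    (α : RationalPoints B (BandSpec C)) : C → B :=
  fun c => (globalSectionsEquiv B).symm
    (pullbackSections (BandSpace.Hom.toHom α) ⊤ (globalSectionsEquiv C c) : SpecSections B ⊤)

/-- The affine topology on `(Spec C)(B) = Hom(C, B)`: the compact-open topology with respect to the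
discrete topology on `C` and the given topology on `B`. -/
noncomputable abbrev affineTopology (B C : BandCat.{u}) [TopologicalSpace B] :
    TopologicalSpace (RationalPoints B (BandSpec C)) :=
  letI : TopologicalSpace C := ⊥
  haveI : DiscreteTopology C := ⟨rfl⟩
  TopologicalSpace.induced (fun α => (⟨α.globalMap, continuous_of_discreteTopology⟩ : C(C, B)))
    ContinuousMap.compactOpen

/-- The fine topology on `X(B)`: the finest topology such that, for every morphism `f` from an
affine band scheme `Spec C` to `X`, the induced map `(Spec C)(B) → X(B)` is continuous with respect
to the affine topology. -/
noncomputable abbrev fineTopology (B : BandCat.{u}) [TopologicalSpace B] (X : BandSpace.{u}) :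
    TopologicalSpace (RationalPoints B X) :=
  ⨆ (C : BandCat.{u}) (f : BandSpec C ⟶ X),
    TopologicalSpace.coinduced
      (fun α : RationalPoints B (BandSpec C) => (α ≫ f : BandSpec B ⟶ X)) (affineTopology B C)

noncomputable instance (B : BandCat.{u}) [TopologicalSpace B] (X : BandSpace.{u}) :
    TopologicalSpace (RationalPoints B X) := fineTopology B X

/-! ## The Krasner hyperfield -/

/-- The underlying set `{0, 1}` of the Krasner hyperfield. -/
inductive Krasner : Type u
  | zero : Krasner
  | one : Krasner

namespace Krasner

instance : Zero Krasner.{u} := ⟨zero⟩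

instance : One Krasner.{u} := ⟨one⟩

instance : Mul Krasner.{u} where
  mul
    | one, one => one
    | _, _ => zero

instance : CommMonoidWithZero Krasner.{u} where
  mul_assoc a b c := by cases a <;> cases b <;> cases c <;> rfl
  mul_comm a b := by cases a <;> cases b <;> rfl
  one_mul a := by cases a <;> rfl
  mul_one a := by cases a <;> rfl
  zero_mul a := by cases a <;> rfl
  mul_zero a := by cases a <;> rfl

instance : DecidableEq Krasner.{u}
  | zero, zero => isTrue rfl
  | zero, one => isFalse nofun
  | one, zero => isFalse nofun
  | one, one => isTrue rfl

/-- The Krasner hyperfield `K = {0, 1}` as a band, with null set `{0, 1 + 1, 1 + 1 + 1, …}`: a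
formal sum is null if and only if the number of its summands `1` is different from one. -/
instance : Band Krasner.{u} where
  nullSet := {s | s.count 1 ≠ 1}
  isAmbientIdeal_nullSet :=
    { zero_mem := by simp
      add_mem := fun {s t} hs ht => by
        simp only [Set.mem_ofPred_eq, Multiset.count_add] at *
        omega
      mul_mem := fun a s hs => by
        cases a with
        | zero =>
          have h : ∀ b : Krasner.{u}, zero * b = zero := fun b => zero_mul b
          change (s.map fun b => zero * b).count one ≠ 1
          simp [h, Multiset.count_replicate]
        | one =>
          have h : ∀ b : Krasner.{u}, one * b = b := fun b => one_mul b
          simpa [h] using hs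
      zero_cons_mem_iff := fun s => by
        have h : (1 : Krasner.{u}) ≠ 0 := nofun
        simp [Multiset.count_cons_of_ne h] }
  existsUnique_neg := by
    intro a
    cases a with
    | zero =>
      refine ⟨zero, by decide, fun b hb => ?_⟩
      cases b with
      | zero => rfl
      | one => exact absurd (by decide) hb
    | one =>
      refine ⟨one, by decide, fun b hb => ?_⟩
      cases b with
      | zero => exact absurd (by decide) hb
      | one => rfl

/-- The natural topology on the Krasner hyperfield, with open subsets `∅`, `{1}` and `{0, 1}`. -/
instance : TopologicalSpace Krasner.{u} := TopologicalSpace.generateFrom {{1}}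

/-- The zero ideal of the Krasner hyperfield, which is the unique point of its spectrum. -/
def zeroIdeal : PrimeMIdeal Krasner.{u} where
  carrier := {0}
  zero_mem := rfl
  mul_mem := fun a b hb => by rw [Set.mem_singleton_iff.1 hb, mul_zero]; rfl
  one_notMem := nofun
  mul_notMem := fun {a b} ha hb => by
    cases a with
    | zero => exact absurd rfl ha
    | one => exact (one_mul b).symm ▸ hb

end Krasner

/-- The Krasner hyperfield as an object of the category of bands. -/
abbrev krasner : BandCat.{u} := ⟨Krasner.{u}⟩

instance : TopologicalSpace krasner.{u} := inferInstanceAs (TopologicalSpace Krasner.{u})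

/-- The characteristic map `X(K) → X`, which sends a `K`-rational point `α : Spec K ⟶ X` to the
image of the unique point of `Spec K`. -/
def characteristicMap (X : BandSpace.{u}) (α : RationalPoints krasner.{u} X) : X :=
  BandSpace.Hom.toFun (X := BandSpec krasner.{u}) α Krasner.zeroIdeal

/-! ## Prime `k`-ideals -/

/-! The kernel space is governed by one intrinsic condition on a point `x`, `IsKPoint`: the
non-units of the stalk at `x` form a `k`-ideal. Preimages of `k`-ideals under band morphisms are
`k`-ideals and stalk maps of morphisms reflect units, so every morphism sends such points to such
points (`IsKPoint.map`). On a spectrum they are exactly the prime `k`-ideals (`isKPoint_spec_iff`),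
and open subspaces have the same stalks; hence the kernel space consists of these points, whatever
the charts (`mem_kernelSpace_iff`).

A point of `Spec K` in `X` is supported at such a point, as the zero ideal of `K` is a `k`-ideal.
Conversely, if the non-units form a `k`-ideal, sending units to `1` and non-units to `0` is a band
morphism from the stalk to `K`, which yields `IsKPoint.toHom`. A morphism from `Spec K` is
determined by its image point, because elements of `K` are determined by whether they are units
(`krasnerPoint_ext`). So `χ` is a bijection onto the kernel space.

For affine `X`, a rational point takes the value `1` at `c` exactly when its image lies in `U_c`, so
the affine topology is induced by `χ` (`affineTopology_krasner`). Continuity of `χ` in general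
follows by naturality. Openness uses affine charts: they are open maps that reflect `k`-points, so a
fine open set corresponds locally to the image of an open subset of a chart.

For (b), the morphism from the stalk to `K` shows that `1` survives in the residue field;
conversely, a nontrivial residue field prevents a unit from being cancelled by non-units. Finally, a
nonempty band scheme has a `k`-point, because a maximal proper `k`-ideal is prime
(`exists_prime_isKIdeal`), so a one-point image must be a `k`-point. -/

theorem Band.eq_zero_of_singleton_mem {B : Type u} [Band B] {a : B}
    (h : ({a} : Multiset B) ∈ Band.nullSet) : a = 0 := by
  have h0 : (0 : B) ::ₘ {a} ∈ Band.nullSet := (Band.isAmbientIdeal_nullSet.zero_cons_mem_iff _).2 h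
  exact (Band.eq_of_pair_mem h0 (Band.pair_neg_mem 0)).trans Band.neg_zero

theorem IsAmbientIdeal.replicate_zero_add_mem_iff {B : Type u} [CommMonoidWithZero B]
    {I : Set (Multiset B)} (hI : IsAmbientIdeal I) (n : ℕ) (s : Multiset B) :
    Multiset.replicate n 0 + s ∈ I ↔ s ∈ I := by
  induction n with
  | zero => simp
  | succ n ih => rw [Multiset.replicate_succ, Multiset.cons_add, hI.zero_cons_mem_iff, ih]

/-- Omitting the zero summands leaves a null sum with the single term `a`, and uniqueness of the
inverse of `0` forces `a = 0`. This ideal starts the Zorn argument and is the point of `Spec K`. -/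
theorem isKIdeal_singleton_zero (B : Type u) [Band B] : IsKIdeal ({0} : Set B) where
  zero_mem := rfl
  mul_mem a b hb := by rw [Set.mem_singleton_iff.1 hb, mul_zero]; rfl
  mem_of_cons_mem a s hs h := by
    rw [Multiset.eq_replicate_card.2 hs, ← Multiset.singleton_add, add_comm,
      Band.isAmbientIdeal_nullSet.replicate_zero_add_mem_iff] at h
    exact Band.eq_zero_of_singleton_mem h

theorem IsKIdeal.comap {B : Type u} {C : Type v} [Band B] [Band C] {I : Set C} (hI : IsKIdeal I)
    (f : BandHom B C) {J : Set B} (h : ∀ a, f a ∈ I ↔ a ∈ J) : IsKIdeal J where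
  zero_mem := by
    rw [← h, map_zero]
    exact hI.zero_mem
  mul_mem a b hb := by
    rw [← h] at hb ⊢
    rw [map_mul]
    exact hI.mul_mem _ hb
  mem_of_cons_mem a s hs has := by
    have h1 := f.map_mem_nullSet has
    rw [Multiset.map_cons] at h1
    refine (h a).1 (hI.mem_of_cons_mem _ _ (fun b hb => ?_) h1)
    obtain ⟨c, hc, rfl⟩ := Multiset.mem_map.1 hb
    exact (h c).2 (hs c hc)

theorem IsKIdeal.comap_nonunits {B : Type u} {C : Type v} [Band B] [Band C] (f : BandHom B C)
    (h : ∀ a, IsUnit (f a) ↔ IsUnit a) (hC : IsKIdeal {a : C | ¬ IsUnit a}) :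
    IsKIdeal {a : B | ¬ IsUnit a} :=
  hC.comap f fun a => not_congr (h a)

/-- Null sums stay null after multiplication by `a`. Colon ideals are what makes maximal `k`-ideals
prime. -/
theorem IsKIdeal.colon {B : Type u} [Band B] {I : Set B} (hI : IsKIdeal I) (a : B) :
    IsKIdeal {c | a * c ∈ I} where
  zero_mem := by
    change a * 0 ∈ I
    rw [mul_zero]
    exact hI.zero_mem
  mul_mem b c hc := by
    change a * (b * c) ∈ I
    rw [mul_left_comm]
    exact hI.mul_mem _ hc
  mem_of_cons_mem c s hs h := by
    have h1 := Band.isAmbientIdeal_nullSet.mul_mem a h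
    rw [Multiset.map_cons] at h1
    refine hI.mem_of_cons_mem _ _ (fun b hb => ?_) h1
    obtain ⟨d, hd, rfl⟩ := Multiset.mem_map.1 hb
    exact hs d hd

/-- A formal sum has finitely many summands, so those lying in the union already lie in one member
of the chain. -/
theorem IsKIdeal.sUnion {B : Type u} [Band B] {c : Set (Set B)} (hc : ∀ I ∈ c, IsKIdeal I)
    (hchain : IsChain (· ⊆ ·) c) (hne : c.Nonempty) : IsKIdeal (⋃₀ c) where
  zero_mem := by
    obtain ⟨I, hI⟩ := hne
    exact ⟨I, hI, (hc I hI).zero_mem⟩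
  mul_mem := by
    rintro a b ⟨I, hI, hb⟩
    exact ⟨I, hI, (hc I hI).mul_mem a hb⟩
  mem_of_cons_mem a s hs h := by
    have key : ∃ I ∈ c, ∀ b ∈ s, b ∈ I := by
      -- The induction runs over sub-multisets of `s`, for which nullity of `a ::ₘ s` says nothing.
      clear h
      induction s using Multiset.induction_on with
      | empty =>
        obtain ⟨I, hI⟩ := hne
        exact ⟨I, hI, by simp⟩
      | cons b s ih =>
        obtain ⟨I, hI, h1⟩ := ih fun d hd => hs d (Multiset.mem_cons_of_mem hd)
        obtain ⟨J, hJ, h2⟩ := hs b (Multiset.mem_cons_self b s)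
        rcases hchain.total hI hJ with hIJ | hIJ
        · refine ⟨J, hJ, fun d hd => ?_⟩
          rcases Multiset.mem_cons.1 hd with rfl | hd
          · exact h2
          · exact hIJ (h1 d hd)
        · refine ⟨I, hI, fun d hd => ?_⟩
          rcases Multiset.mem_cons.1 hd with rfl | hd
          · exact hIJ h2
          · exact h1 d hd
    obtain ⟨I, hI, h1⟩ := key
    exact ⟨I, hI, (hc I hI).mem_of_cons_mem a s h1 h⟩

/-- A nonzero band has a prime `k`-ideal. -/
theorem exists_prime_isKIdeal (B : Type u) [Band B] (h01 : (0 : B) ≠ 1) :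
    ∃ p : PrimeMIdeal B, IsKIdeal p.carrier := by
  obtain ⟨m, -, hm⟩ := zorn_subset_nonempty {I : Set B | IsKIdeal I ∧ (1 : B) ∉ I}
    (fun c hc hchain hne => ⟨⋃₀ c, ⟨IsKIdeal.sUnion (fun I hI => (hc hI).1) hchain hne, by
      rintro ⟨I, hI, h⟩
      exact (hc hI).2 h⟩, fun I hI => Set.subset_sUnion_of_mem hI⟩)
    {0} ⟨isKIdeal_singleton_zero B, fun h => h01 (Set.mem_singleton_iff.1 h).symm⟩
  obtain ⟨⟨hk, h1⟩, hmax⟩ := hm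
  refine ⟨⟨m, hk.zero_mem, hk.mul_mem, h1, fun {a b} ha hb hab => hb ?_⟩, hk⟩
  -- The colon ideal `(m : a)` contains `m` and is proper since `a ∉ m`; by maximality it equals
  -- `m`, and it contains `b`.
  refine hmax (y := {c | a * c ∈ m}) ⟨hk.colon a, ?_⟩ (fun c hc => hk.mul_mem a hc) hab
  rw [Set.mem_ofPred_eq, mul_one]
  exact ha

/-! ## Morphisms to the Krasner hyperfield -/

theorem Krasner.eq_zero_or_eq_one (a : Krasner.{u}) : a = 0 ∨ a = 1 := by
  cases a
  · exact Or.inl rfl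
  · exact Or.inr rfl

open Classical in
/-- The morphism to the Krasner hyperfield whose zero set is a given prime `k`-ideal. -/
noncomputable def PrimeMIdeal.toKrasner {B : Type u} [Band B] (p : PrimeMIdeal B)
    (hp : IsKIdeal p.carrier) : BandHom B Krasner.{v} where
  toFun a := if a ∈ p.carrier then 0 else 1
  map_zero' := if_pos p.zero_mem
  map_one' := if_neg p.one_notMem
  map_mul' a b := by
    by_cases hb : b ∈ p.carrier
    · simp only [hb, p.mul_mem a hb, if_true, mul_zero]
    · by_cases ha : a ∈ p.carrier
      · simp only [ha, mul_comm a b, p.mul_mem b ha, if_true, zero_mul]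
      · simp only [ha, hb, p.mul_notMem ha hb, if_false, mul_one]
  map_mem_nullSet' s hs := by
    change (s.map fun a => if a ∈ p.carrier then (0 : Krasner.{v}) else 1).count 1 ≠ 1
    -- A sum in `K` fails to be null only if exactly one summand is `1`. Then exactly one summand of
    -- `s` lies outside `p`, which the `k`-ideal property forbids.
    intro h
    have h1 : (1 : Krasner.{v}) ∈ s.map fun a => if a ∈ p.carrier then (0 : Krasner.{v}) else 1 :=
      Multiset.count_pos.1 (by omega)
    obtain ⟨a, ha, ha1⟩ := Multiset.mem_map.1 h1
    obtain ⟨t, rfl⟩ := Multiset.exists_cons_of_mem ha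
    rw [Multiset.map_cons, ha1, Multiset.count_cons_self, Nat.add_eq_right,
      Multiset.count_eq_zero] at h
    have hap : a ∈ p.carrier := hp.mem_of_cons_mem a t (fun b hb => by
      by_contra hbp
      exact h (Multiset.mem_map.2 ⟨b, hb, if_neg hbp⟩)) hs
    rw [if_pos hap] at ha1
    cases ha1

theorem PrimeMIdeal.toKrasner_eq_zero_iff {B : Type u} [Band B] (p : PrimeMIdeal B)
    (hp : IsKIdeal p.carrier) (a : B) : p.toKrasner hp a = (0 : Krasner.{v}) ↔ a ∈ p.carrier := by
  classical
  change (if a ∈ p.carrier then (0 : Krasner.{v}) else 1) = 0 ↔ _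
  split_ifs with h
  · exact iff_of_true rfl h
  · exact iff_of_false (fun h1 => by cases h1) h

/-! ## Kernels and residue fields -/

/-- The preimage of the null set under a band morphism is a null ideal. -/
theorem BandHom.isNullIdeal_ker {B : Type u} {C : Type v} [Band B] [Band C] (f : BandHom B C) :
    IsNullIdeal {s : Multiset B | s.map f ∈ Band.nullSet} where
  zero_mem := by simpa using Band.isAmbientIdeal_nullSet.zero_mem
  add_mem hs ht := by
    rw [Set.mem_ofPred_eq, Multiset.map_add]
    exact Band.isAmbientIdeal_nullSet.add_mem hs ht
  mul_mem a s hs := by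
    have h := Band.isAmbientIdeal_nullSet.mul_mem (f a) hs
    simpa [Multiset.map_map, Function.comp_def] using h
  zero_cons_mem_iff s := by
    rw [Set.mem_ofPred_eq, Multiset.map_cons, map_zero]
    exact Band.isAmbientIdeal_nullSet.zero_cons_mem_iff _
  nullSet_subset s hs := f.map_mem_nullSet hs
  substitution a c t h h' := by
    -- Both `f a` and `f c` are additive inverses of `f (-c)`.
    have e : f a = f c := by
      have h1 : ({f (Band.neg c), f a} : Multiset C) ∈ Band.nullSet := by
        rw [Multiset.pair_comm]
        simpa using h
      have h2 : ({f (Band.neg c), f c} : Multiset C) ∈ Band.nullSet := by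
        rw [Multiset.pair_comm]
        simpa using f.map_mem_nullSet (Band.pair_neg_mem c)
      exact Band.eq_of_pair_mem h1 h2
    rw [Set.mem_ofPred_eq, Multiset.map_cons] at h' ⊢
    rwa [e]

section Residue

variable {B : Type u} [Band B]

theorem BandQuotient.mk_eq_zero_iff {I : Set (Multiset B)} (hI : IsNullIdeal I) (a : B) :
    mk hI a = 0 ↔ ({a} : Multiset B) ∈ I := by
  rw [← mk_zero, mk_eq_mk_iff, Band.neg_zero, Multiset.pair_comm]
  exact hI.zero_cons_mem_iff {a}

/-- The null ideal that is generated by the non-units. -/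
abbrev nonunitsNullIdeal (B : Type u) [Band B] : Set (Multiset B) :=
  nullSpan ((fun a : B => ({a} : Multiset B)) '' {a | ¬ IsUnit a})

theorem singleton_mem_nonunitsNullIdeal {a : B} (ha : ¬ IsUnit a) :
    ({a} : Multiset B) ∈ nonunitsNullIdeal B :=
  fun _ hI => hI.2 ⟨a, ha, rfl⟩

/-- The morphism to `K` that vanishes on the non-units has as kernel a null ideal containing the
generators but not `1`. A nonzero class has only units as representatives, hence is a unit. -/
theorem isIdyll_residue (hk : IsKIdeal {a : B | ¬ IsUnit a}) :
    IsIdyll (BandQuotient (isNullIdeal_nullSpan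
      ((fun a : B => ({a} : Multiset B)) '' {a | ¬ IsUnit a}))) := by
  constructor
  · intro h
    rw [eq_comm, ← BandQuotient.mk_one, BandQuotient.mk_eq_zero_iff] at h
    let p := maximalMIdeal B hk.zero_mem
    have h1 := h _ ⟨(p.toKrasner hk : BandHom B Krasner.{u}).isNullIdeal_ker, by
      rintro _ ⟨a, ha, rfl⟩
      have e : p.toKrasner hk a = (0 : Krasner.{u}) := (p.toKrasner_eq_zero_iff hk a).2 ha
      rw [Set.mem_ofPred_eq, Multiset.map_singleton, e]
      exact (Band.isAmbientIdeal_nullSet.zero_cons_mem_iff 0).2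
        Band.isAmbientIdeal_nullSet.zero_mem⟩
    rw [Set.mem_ofPred_eq, Multiset.map_singleton] at h1
    exact (p.toKrasner_eq_zero_iff hk 1).1 (Band.eq_zero_of_singleton_mem h1) isUnit_one
  · intro x hx
    obtain ⟨a, rfl⟩ := BandQuotient.mk_surjective _ x
    have ha : IsUnit a := by
      by_contra ha
      exact hx ((BandQuotient.mk_eq_zero_iff _ a).2 (singleton_mem_nonunitsNullIdeal ha))
    obtain ⟨b, hb⟩ := ha.exists_right_inv
    exact IsUnit.of_mul_eq_one (BandQuotient.mk _ b) (by
      rw [← BandQuotient.mk_mul, hb, BandQuotient.mk_one])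

/-- If a unit were killed, so would be `1`. In a null sum `a + ∑ bᵢ` with all `bᵢ` non-units, the
`bᵢ` vanish in the quotient, so `a` is killed as well and cannot be a unit. -/
theorem isKIdeal_nonunits_of_nontrivial_residue
    (h : Nontrivial (BandQuotient (isNullIdeal_nullSpan
      ((fun a : B => ({a} : Multiset B)) '' {a | ¬ IsUnit a})))) :
    IsKIdeal {a : B | ¬ IsUnit a} := by
  have hunit : ∀ a : B, IsUnit a → ({a} : Multiset B) ∉ nonunitsNullIdeal B := by
    intro a ha hmem
    rw [← BandQuotient.mk_eq_zero_iff (isNullIdeal_nullSpan _)] at hmem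
    obtain ⟨b, hb⟩ := ha.exists_right_inv
    have h1 : (1 : BandQuotient (isNullIdeal_nullSpan
      ((fun a : B => ({a} : Multiset B)) '' {a | ¬ IsUnit a}))) = 0 := by
      rw [← BandQuotient.mk_one, ← hb, BandQuotient.mk_mul, hmem, zero_mul]
    exact zero_ne_one h1.symm
  have hJ := isNullIdeal_nullSpan ((fun a : B => ({a} : Multiset B)) '' {a | ¬ IsUnit a})
  refine ⟨fun h0 => hunit 0 h0 ?_, fun a b hb hab => hb (isUnit_of_mul_isUnit_right hab),
    fun a s hs has ha => hunit a ha ?_⟩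
  · exact (hJ.zero_cons_mem_iff 0).2 hJ.zero_mem
  -- Each summand of `s` is traded for a `0`, which has the same class; membership in the null ideal
  -- depends only on the classes.
  · refine (hJ.replicate_zero_add_mem_iff s.card {a}).1
      (BandQuotient.mem_of_map_mk_eq hJ (hJ.nullSet_subset has) ?_)
    rw [Multiset.map_cons, Multiset.map_add, Multiset.map_singleton, add_comm,
      Multiset.singleton_add, Multiset.map_replicate]
    congr 1
    refine Multiset.eq_replicate.2 ⟨Multiset.card_map _ _, fun x hx => ?_⟩
    obtain ⟨b, hb, rfl⟩ := Multiset.mem_map.1 hx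
    exact (BandQuotient.mk_eq_zero_iff hJ b).2 (singleton_mem_nonunitsNullIdeal (hs b hb))

end Residue

/-! ## Localizations at prime ideals -/

theorem PrimeMIdeal.isUnit_localizationMk_iff {B : Type u} [Band B] (p : PrimeMIdeal B) (a : B)
    (s : p.compl) : IsUnit (Localization.mk a s) ↔ a ∉ p.carrier := by
  constructor
  · intro h ha
    obtain ⟨x, hx⟩ := h.exists_right_inv
    induction x using Localization.induction_on with
    | H y =>
      obtain ⟨b, t⟩ := y
      rw [Localization.mk_mul, ← Localization.mk_one, Localization.mk_eq_mk_iff,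
        Localization.r_iff_exists] at hx
      obtain ⟨c, hc⟩ := hx
      have h1 : (c : B) * ((1 : B) * (a * b)) ∈ p.carrier := by
        rw [one_mul, mul_comm a, ← mul_assoc]
        exact p.mul_mem _ ha
      have hc' : (c : B) * ((1 : B) * (a * b)) = c * ((s * t : p.compl) * 1) := hc
      rw [hc', mul_one] at h1
      exact (c * (s * t)).2 h1
  · intro ha
    refine IsUnit.of_mul_eq_one (Localization.mk (s : B) ⟨a, ha⟩) ?_
    rw [Localization.mk_mul, ← Localization.mk_one, Localization.mk_eq_mk_iff,
      Localization.r_iff_exists]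
    refine ⟨1, ?_⟩
    change 1 * (1 * (a * s)) = 1 * (s * a * 1)
    rw [one_mul, one_mul, one_mul, mul_one, mul_comm]

/-- Multiplication by a suitable `t ∉ p` turns a null sum of the localization into the image of a
null sum of `B`. As `t` becomes a unit, units and non-units are kept apart, and the `k`-ideal
property of `p` applies to the lifted sum. -/
theorem IsKIdeal.nonunits_localization {B : Type u} [Band B] {p : PrimeMIdeal B}
    (hp : IsKIdeal p.carrier) : IsKIdeal {x : Localization p.compl | ¬ IsUnit x} := by
  refine ⟨fun h0 => ?_, fun a b hb hab => hb (isUnit_of_mul_isUnit_right hab),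
    fun x s hs hxs hx => ?_⟩
  · rw [← Localization.mk_zero 1, p.isUnit_localizationMk_iff] at h0
    exact h0 p.zero_mem
  · obtain ⟨t, m, hm, h⟩ := (mem_localizationNullSet_iff _).1 hxs
    have ht : IsUnit (Localization.mk (t : B) (1 : p.compl)) :=
      (p.isUnit_localizationMk_iff _ _).2 t.2
    rw [Multiset.map_cons] at h
    have h1 : Localization.mk (t : B) (1 : p.compl) * x ∈
        m.map (fun a => Localization.mk a (1 : p.compl)) := by rw [h]; simp
    obtain ⟨a, ha, hax⟩ := Multiset.mem_map.1 h1
    obtain ⟨m', rfl⟩ := Multiset.exists_cons_of_mem ha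
    rw [Multiset.map_cons, hax] at h
    have h2 := (Multiset.cons_inj_right _).1 h
    have hap : a ∉ p.carrier := by
      rw [← p.isUnit_localizationMk_iff a 1, hax]
      exact ht.mul hx
    refine hap (hp.mem_of_cons_mem a m' (fun b hb => ?_) hm)
    by_contra hbp
    have h3 : Localization.mk b (1 : p.compl) ∈
        m'.map (fun a => Localization.mk a (1 : p.compl)) := Multiset.mem_map_of_mem _ hb
    rw [h2] at h3
    obtain ⟨y, hy, hyb⟩ := Multiset.mem_map.1 h3
    refine hs y hy (isUnit_of_mul_isUnit_right (x := Localization.mk (t : B) (1 : p.compl)) ?_)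
    rw [hyb]
    exact (p.isUnit_localizationMk_iff b 1).2 hbp

/-! ## Stalks and the kernel space -/

theorem BandStalk.isUnit_germ_iff {X : TopCat.{u}} {F : X.Presheaf BandCat.{u}} {x : X}
    {U : Opens X} (hx : x ∈ U) (s : F.obj (op U)) :
    IsUnit (germ F x U hx s) ↔
      ∃ (V : Opens X) (_ : x ∈ V) (h : V ≤ U) (t : F.obj (op V)), BandStalk.res F h s * t = 1 := by
  constructor
  · intro hs
    obtain ⟨b, hb⟩ := hs.exists_right_inv
    obtain ⟨V, hV, t, rfl⟩ := exists_germ_eq b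
    have hUV : x ∈ U ⊓ V := ⟨hx, hV⟩
    rw [← germ_res (inf_le_left : U ⊓ V ≤ U) hUV, ← germ_res (inf_le_right : U ⊓ V ≤ V) hUV,
      ← map_mul, ← map_one (germ F x (U ⊓ V) hUV), germ_eq_iff] at hb
    obtain ⟨W, hW, h, _, e⟩ := hb
    refine ⟨W, hW, h.trans inf_le_left, res F (h.trans inf_le_right) t, ?_⟩
    rw [map_mul, map_one, res_res, res_res] at e
    exact e
  · rintro ⟨V, hV, h, t, e⟩
    refine IsUnit.of_mul_eq_one (germ F x V hV t) ?_
    rw [← germ_res h hV, ← map_mul, e, map_one]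

/-- The morphism from sections to the stalk. -/
def BandStalk.germHom {X : TopCat.{u}} (F : X.Presheaf BandCat.{u}) (x : X) (U : Opens X)
    (hx : x ∈ U) : BandHom (F.obj (op U)) (BandStalk F x) where
  __ := germ F x U hx
  map_mem_nullSet' s hs := ⟨U, hx, s, hs, rfl⟩

/-! ### Units in the stalks of a spectrum -/

section Spec

variable {B : BandCat.{u}}

/-- The evaluation of germs of the structure sheaf of a spectrum in the localization. -/
def specStalkEval (p : PrimeMIdeal B) :
    BandHom (BandStalk (X := TopCat.of (PrimeMIdeal B)) (specPresheaf B) p)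
      (Localization p.compl) where
  toFun := Quotient.lift (fun r => (show SpecSections B r.nhd from r.sec).1 ⟨p, r.mem⟩) (by
    rintro ⟨U, hU, s⟩ ⟨V, hV, t⟩ ⟨W, hW, hs, ht, e⟩
    exact congrArg (fun s : SpecSections B W => s.1 ⟨p, hW⟩) e)
  map_zero' := rfl
  map_one' := rfl
  map_mul' a b := by
    obtain ⟨U, hU, s, t, rfl, rfl⟩ := BandStalk.exists_mk_eq₂ a b
    rw [BandStalk.mk_mul_mk]
    rfl
  map_mem_nullSet' := by
    rintro _ ⟨U, hU, s, hs, rfl⟩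
    refine Eq.mpr (congrArg (· ∈ Band.nullSet) (Multiset.map_map _ _ s)) ?_
    exact (show ∀ p : U, s.map (SpecSections.eval p) ∈ Band.nullSet from hs) ⟨p, hU⟩

/-- A section that is `a / f` near `p` with `a ∉ p` has the inverse `f / a` wherever `a` is outside
the prime. -/
theorem isUnit_specStalkEval_iff (p : PrimeMIdeal B)
    (a : BandStalk (X := TopCat.of (PrimeMIdeal B)) (specPresheaf B) p) :
    IsUnit (specStalkEval p a) ↔ IsUnit a := by
  refine ⟨fun h => ?_, fun h => h.map (specStalkEval p)⟩
  obtain ⟨U, hU, s, rfl⟩ := BandStalk.exists_germ_eq a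
  obtain ⟨V, hV, a, f, hs⟩ := (show SpecSections B U from s).2 ⟨p, hU⟩
  have hp := hs ⟨p, hU⟩ hV
  obtain ⟨hf, e⟩ := hp
  have ha : a ∉ p.carrier := by
    rw [← p.isUnit_localizationMk_iff a ⟨f, hf⟩, ← e]
    exact h
  let W : Opens (PrimeMIdeal B) := U ⊓ V ⊓ ⟨_, PrimeMIdeal.isOpen_principalOpen a⟩
  have hW : ∀ q : PrimeMIdeal B, q ∈ W → q ∈ U ∧ q ∈ V ∧ a ∉ q.carrier :=
    fun q hq => ⟨hq.1.1, hq.1.2, hq.2⟩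
  let t : SpecSections B W := ⟨fun q => Localization.mk f ⟨a, (hW q.1 q.2).2.2⟩, fun q =>
    ⟨⊤, trivial, f, a, fun q' _ => ⟨(hW q'.1 q'.2).2.2, rfl⟩⟩⟩
  refine (BandStalk.isUnit_germ_iff hU s).2 ⟨W, ⟨⟨hU, hV⟩, ha⟩, fun q hq => (hW q hq).1, t, ?_⟩
  refine SpecSections.ext fun q => ?_
  obtain ⟨hfq, e'⟩ := hs ⟨q.1, (hW q.1 q.2).1⟩ (hW q.1 q.2).2.1
  change (show SpecSections B U from s).1 ⟨q.1, (hW q.1 q.2).1⟩ *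
    Localization.mk f ⟨a, (hW q.1 q.2).2.2⟩ = 1
  rw [e', Localization.mk_mul, ← Localization.mk_one, Localization.mk_eq_mk_iff,
    Localization.r_iff_exists]
  refine ⟨1, ?_⟩
  change 1 * (1 * (a * f)) = 1 * (f * a * 1)
  rw [one_mul, one_mul, one_mul, mul_one, mul_comm]

/-- The morphism from a band to a stalk of its spectrum. -/
def toSpecStalk (p : PrimeMIdeal B) :
    BandHom B (BandStalk (X := TopCat.of (PrimeMIdeal B)) (specPresheaf B) p) :=
  (BandStalk.germHom (X := TopCat.of (PrimeMIdeal B)) (specPresheaf B) p ⊤ trivial).comp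
    (toGlobalSections B)

theorem isUnit_toSpecStalk_iff (p : PrimeMIdeal B) (a : B) :
    IsUnit (toSpecStalk p a) ↔ a ∉ p.carrier := by
  rw [← isUnit_specStalkEval_iff, ← p.isUnit_localizationMk_iff a 1]
  rfl

end Spec

namespace BandSpace

/-- The points whose stalk has a `k`-ideal as its maximal `m`-ideal. -/
def IsKPoint (X : BandSpace.{u}) (x : X) : Prop := IsKIdeal (X.maximalIdeal x)

/-- Both directions are pullbacks, along `B` to the stalk and along the stalk to the localization.
Only the behaviour of units under these maps matters, not that the second is an isomorphism. -/
theorem isKPoint_spec_iff {B : BandCat.{u}} (p : BandSpec B) :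
    IsKPoint (BandSpec B) p ↔ IsKIdeal (show PrimeMIdeal B from p).carrier :=
  ⟨fun h => IsKIdeal.comap (C := (BandSpec B).stalk p) h (toSpecStalk p) fun a =>
      (not_congr (isUnit_toSpecStalk_iff p a)).trans not_not,
    fun h => IsKIdeal.comap_nonunits (B := (BandSpec B).stalk p) (specStalkEval p)
      (isUnit_specStalkEval_iff p) h.nonunits_localization⟩

theorem Hom.isUnit_stalkMap_iff {X Y : BandSpace.{u}} (f : X ⟶ Y) (x : X)
    (a : Y.stalk (Hom.toFun f x)) : IsUnit (stalkMap (Hom.toHom f) x a) ↔ IsUnit a :=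
  ⟨fun h => by
    by_contra ha
    exact Hom.isLocal f x a ha h, fun h => h.map (stalkMap (Hom.toHom f) x)⟩

/-- The stalk map goes from the stalk of `Y` to that of `X` and reflects units, so the `k`-ideal
pulls back. -/
theorem IsKPoint.map {X Y : BandSpace.{u}} (f : X ⟶ Y) {x : X} (hx : IsKPoint X x) :
    IsKPoint Y (Hom.toFun f x) :=
  IsKIdeal.comap_nonunits (stalkMap (Hom.toHom f) x) (Hom.isUnit_stalkMap_iff f x) hx

/-! ### Stalks of open subspaces -/

section Restrict

variable (X : BandSpace.{u}) (U : Opens X)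

/-- The inclusion of an open subspace, as a morphism of sheafed spaces. -/
def restrictHom : (X.restrict U).toSheafedSpace ⟶ X.toSheafedSpace :=
  X.toSheafedSpace.ofRestrict (U := TopCat.of U)
    (f := TopCat.ofHom ⟨Subtype.val, continuous_subtype_val⟩) U.isOpen.isOpenEmbedding_subtypeVal

/-- An open subset of an open subspace, as an open subset of the whole space. -/
def imageOpens (V : Opens U) : Opens X :=
  ⟨Subtype.val '' (V : Set U), U.isOpen.isOpenMap_subtype_val _ V.isOpen⟩

variable {X U}

/-- The morphism from the stalks of an open subspace to the stalks of the whole space. -/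
def restrictStalkMap (x : X.restrict U) :
    BandHom ((X.restrict U).stalk x) (X.stalk ((restrictHom X U).hom.base x)) where
  toFun := Quotient.lift
    (fun s => BandStalk.germ X.presheaf _ (imageOpens X U s.nhd) ⟨x, s.mem, rfl⟩ s.sec) (by
    rintro ⟨V, hV, s⟩ ⟨V', hV', t⟩ ⟨W, hW, hs, ht, e⟩
    exact (BandStalk.germ_eq_iff _ _ _ _).2 ⟨imageOpens X U W, ⟨x, hW, rfl⟩,
      Set.image_mono hs, Set.image_mono ht, e⟩)
  map_zero' := map_zero (BandStalk.germ X.presheaf _ (imageOpens X U ⊤) ⟨x, trivial, rfl⟩)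
  map_one' := map_one (BandStalk.germ X.presheaf _ (imageOpens X U ⊤) ⟨x, trivial, rfl⟩)
  map_mul' a b := by
    obtain ⟨V, hV, s, t, rfl, rfl⟩ := BandStalk.exists_mk_eq₂ a b
    rw [BandStalk.mk_mul_mk]
    exact map_mul (BandStalk.germ X.presheaf _ (imageOpens X U V) ⟨x, hV, rfl⟩) s t
  map_mem_nullSet' := by
    rintro _ ⟨V, hV, s, hs, rfl⟩
    refine ⟨imageOpens X U V, ⟨x, hV, rfl⟩, s, hs, ?_⟩
    refine Eq.trans ?_
      (Multiset.map_map _ (BandStalk.germ (X.restrict U).presheaf x V hV) s).symm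
    rfl

theorem restrictStalkMap_stalkMap (x : X.restrict U)
    (a : X.stalk ((restrictHom X U).hom.base x)) :
    restrictStalkMap x (stalkMap (restrictHom X U) x a) = a := by
  obtain ⟨V, hV, s, rfl⟩ := BandStalk.exists_germ_eq a
  exact BandStalk.germ_res (F := X.presheaf) (V := imageOpens X U
    ((Opens.map (restrictHom X U).hom.base).obj V)) (by rintro _ ⟨y, hy, rfl⟩; exact hy)
    ⟨x, hV, rfl⟩ s

theorem stalkMap_restrictStalkMap (x : X.restrict U) (a : (X.restrict U).stalk x) :
    stalkMap (restrictHom X U) x (restrictStalkMap x a) = a := by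
  obtain ⟨V, hV, s, rfl⟩ := BandStalk.exists_germ_eq a
  have h : (Opens.map (restrictHom X U).hom.base).obj (imageOpens X U V) ≤ V := by
    rintro y ⟨z, hz, e⟩
    exact (Subtype.ext e : z = y) ▸ hz
  exact BandStalk.germ_res (F := (X.restrict U).presheaf) h ⟨x, hV, rfl⟩ s

variable (X U)

/-- The inclusion of an open subspace. -/
def ι : X.restrict U ⟶ X where
  toHom := restrictHom X U
  isLocal x a ha h := ha (by
    have h1 := h.map (restrictStalkMap x)
    rwa [restrictStalkMap_stalkMap] at h1)

/-- The converse of `IsKPoint.map` for open inclusions: here the stalk map has an inverse, along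
which the `k`-ideal is pulled back. -/
theorem IsKPoint.restrict {x : X.restrict U} (hx : IsKPoint X (Hom.toFun (ι X U) x)) :
    IsKPoint (X.restrict U) x := by
  refine IsKIdeal.comap_nonunits (restrictStalkMap (X := X) (U := U) x) (fun a => ⟨fun h => ?_,
    fun h => h.map (restrictStalkMap (X := X) (U := U) x)⟩) hx
  have h1 := h.map (stalkMap (restrictHom X U) x)
  rwa [stalkMap_restrictStalkMap] at h1

end Restrict

/-! ### The kernel space in terms of stalks -/

theorem Hom.comp_toFun {X Y Z : BandSpace.{u}} (f : X ⟶ Y) (g : Y ⟶ Z) (x : X) :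
    Hom.toFun (f ≫ g) x = Hom.toFun g (Hom.toFun f x) := rfl

theorem hom_inv_toFun {X Y : BandSpace.{u}} (e : X ≅ Y) (x : X) :
    Hom.toFun e.inv (Hom.toFun e.hom x) = x := by
  rw [← Hom.comp_toFun, e.hom_inv_id]
  rfl

theorem inv_hom_toFun {X Y : BandSpace.{u}} (e : X ≅ Y) (y : Y) :
    Hom.toFun e.hom (Hom.toFun e.inv y) = y := by
  rw [← Hom.comp_toFun, e.inv_hom_id]
  rfl

/-- The condition on stalks passes from a chart to `X` along morphisms, and from `X` to any affine
chart by restriction. -/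
theorem mem_kernelSpace_iff (X : BandScheme.{u}) (x : X) :
    x ∈ X.kernelSpace ↔ IsKPoint X.toBandSpace x := by
  constructor
  · rintro ⟨U, hx, B, e, h⟩
    have h1 := (((isKPoint_spec_iff _).2 h).map e.inv).map (ι X.toBandSpace U)
    have h2 : Hom.toFun (ι X.toBandSpace U) (Hom.toFun e.inv (Hom.toFun e.hom ⟨x, hx⟩)) = x :=
      congrArg (Hom.toFun (ι X.toBandSpace U)) (hom_inv_toFun e _)
    exact h2 ▸ h1
  · intro h
    obtain ⟨U, hx, B, ⟨e⟩⟩ := X.exists_affine x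
    exact ⟨U, hx, B, e, (isKPoint_spec_iff _).1
      ((IsKPoint.restrict X.toBandSpace U (x := ⟨x, hx⟩) h).map e.hom)⟩

end BandSpace

/-! ## Points with values in the Krasner hyperfield -/

theorem Krasner.mem_carrier_iff (p : PrimeMIdeal Krasner.{u}) (a : Krasner.{u}) :
    a ∈ p.carrier ↔ a = 0 := by
  rcases a.eq_zero_or_eq_one with rfl | rfl
  · exact iff_of_true p.zero_mem rfl
  · exact iff_of_false p.one_notMem nofun

theorem Krasner.eq_zeroIdeal (p : PrimeMIdeal Krasner.{u}) : p = zeroIdeal :=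
  PrimeMIdeal.ext (Set.ext fun a => mem_carrier_iff p a)

theorem Krasner.isKIdeal_zeroIdeal : IsKIdeal zeroIdeal.{u}.carrier :=
  isKIdeal_singleton_zero Krasner.{u}

/-- The complement of `p` is `{1}`, so the localization consists of a non-unit `0` and a unit `1`.
-/
theorem Krasner.localization_eq {p : PrimeMIdeal Krasner.{u}} {x y : Localization p.compl}
    (h : IsUnit x ↔ IsUnit y) : x = y := by
  have key : ∀ x : Localization p.compl, x = 0 ∧ ¬ IsUnit x ∨ x = 1 ∧ IsUnit x := by
    intro x
    induction x using Localization.induction_on with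
    | H z =>
      obtain ⟨a, s, hs⟩ := z
      have hs1 : s = 1 := s.eq_zero_or_eq_one.resolve_left fun h => hs ((mem_carrier_iff p s).2 h)
      subst hs1
      rcases a.eq_zero_or_eq_one with rfl | rfl
      · exact Or.inl ⟨Localization.mk_zero _, fun h =>
          (p.isUnit_localizationMk_iff _ _).1 h p.zero_mem⟩
      · exact Or.inr ⟨Localization.mk_one, (p.isUnit_localizationMk_iff _ _).2 p.one_notMem⟩
  rcases key x with ⟨rfl, hx⟩ | ⟨rfl, hx⟩ <;> rcases key y with ⟨rfl, hy⟩ | ⟨rfl, hy⟩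
  · rfl
  · exact absurd (h.2 hy) hx
  · exact absurd (h.1 hx) hy
  · rfl

namespace BandSpace

/-- The stalk map of `α` and the evaluation of germs at `q` both preserve and reflect units. Hence
the image point alone decides where a pulled back section is invertible. -/
theorem isUnit_pullbackSections_iff {B : BandCat.{u}} {X : BandSpace.{u}} (α : BandSpec B ⟶ X)
    (U : Opens X) (s : X.presheaf.obj (op U)) (q : PrimeMIdeal B)
    (hq : Hom.toFun (X := BandSpec B) α q ∈ U) :
    IsUnit ((show SpecSections B ((Opens.map (Hom.toHom α).hom.base).obj U) from
      pullbackSections (Hom.toHom α) U s).1 ⟨q, hq⟩) ↔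
      IsUnit (BandStalk.germ X.presheaf (Hom.toFun (X := BandSpec B) α q) U hq s) := by
  rw [← Hom.isUnit_stalkMap_iff (X := BandSpec B) α q]
  exact isUnit_specStalkEval_iff q (stalkMap (Hom.toHom α) q
    (BandStalk.germ X.presheaf (Hom.toFun (X := BandSpec B) α q) U hq s))

theorem krasnerPoint_ext {X : BandSpace.{u}} {α β : BandSpec krasner.{u} ⟶ X}
    (h : ∀ q : BandSpec krasner.{u}, Hom.toFun α q = Hom.toFun β q) : α = β := by
  have hα := isUnit_pullbackSections_iff α
  have hβ := isUnit_pullbackSections_iff β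
  obtain ⟨⟨⟨b, c⟩⟩, l⟩ := α
  obtain ⟨⟨⟨b', c'⟩⟩, l'⟩ := β
  obtain rfl : b = b' := TopCat.ext h
  -- With equal base maps, both pulled back sections are units exactly when the same germ is, which
  -- determines their values over `K`.
  obtain rfl : c = c' := NatTrans.ext (funext fun U => BandHom.ext fun s =>
    SpecSections.ext fun q => Krasner.localization_eq
      ((hα U.unop s q.1 q.2).trans (hβ U.unop s q.1 q.2).symm))
  rfl

/-- The morphism from the stalk to the Krasner hyperfield. -/
noncomputable def IsKPoint.stalkToKrasner {X : BandSpace.{u}} {x : X} (hx : IsKPoint X x) :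
    BandHom (X.stalk x) Krasner.{u} :=
  (maximalMIdeal (X.stalk x) hx.zero_mem).toKrasner hx

theorem IsKPoint.stalkToKrasner_eq_zero_iff {X : BandSpace.{u}} {x : X} (hx : IsKPoint X x)
    (a : X.stalk x) : hx.stalkToKrasner a = 0 ↔ ¬ IsUnit a :=
  (maximalMIdeal (X.stalk x) hx.zero_mem).toKrasner_eq_zero_iff hx a

/-- The pull back of sections to the spectrum of the Krasner hyperfield. -/
noncomputable def IsKPoint.pullback {X : BandSpace.{u}} {x : X} (hx : IsKPoint X x) (U : Opens X)
    (V : Opens (PrimeMIdeal Krasner.{u})) (hV : ∀ q ∈ V, x ∈ U) :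
    BandHom (X.presheaf.obj (op U)) (SpecSections Krasner.{u} V) where
  -- The germ at `x` is formed only at points `q` of `V`, so for empty `V` the condition `x ∈ U` is
  -- not needed.
  toFun s := ⟨fun q => Localization.mk
      (hx.stalkToKrasner (BandStalk.germ X.presheaf x U (hV q.1 q.2) s)) 1,
    fun q => ⟨⊤, trivial, hx.stalkToKrasner (BandStalk.germ X.presheaf x U (hV q.1 q.2) s), 1,
      fun _ _ => ⟨one_mem _, rfl⟩⟩⟩
  map_zero' := SpecSections.ext fun q => by
    dsimp only
    rw [map_zero, map_zero]
    exact Localization.mk_zero _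
  map_one' := SpecSections.ext fun q => by
    dsimp only
    rw [map_one, map_one]
    exact Localization.mk_one
  map_mul' s t := SpecSections.ext fun q => by
    dsimp only
    rw [map_mul, map_mul]
    refine Eq.symm (Eq.trans (Localization.mk_mul _ _ _ _) ?_)
    rw [mul_one]
  map_mem_nullSet' s hs q := by
    refine subset_ambientSpan _ ⟨(s.map (BandStalk.germHom X.presheaf x U (hV q.1 q.2))).map
      hx.stalkToKrasner, BandHom.map_mem_nullSet _ (BandHom.map_mem_nullSet _ hs), ?_⟩
    rw [Multiset.map_map, Multiset.map_map, Multiset.map_map]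
    rfl

/-- The point with values in the Krasner hyperfield that is supported at a given point. -/
noncomputable def IsKPoint.toHom {X : BandSpace.{u}} {x : X} (hx : IsKPoint X x) :
    BandSpec krasner.{u} ⟶ X where
  toHom := InducedCategory.homMk
    { base := TopCat.ofHom ⟨fun _ => x, continuous_const⟩
      c :=
        { app := fun U => hx.pullback U.unop
            ((Opens.map (TopCat.ofHom ⟨fun _ => x, continuous_const⟩)).obj U.unop)
            (fun q hq => hq)
          naturality := fun U V f => BandHom.ext fun s => SpecSections.ext fun q =>
            congrArg (fun a => Localization.mk (hx.stalkToKrasner a) 1)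
              (BandStalk.germ_res (F := X.presheaf) f.unop.le q.2 s) } }
  isLocal q a ha h := by
    obtain ⟨U, hU, s, rfl⟩ := BandStalk.exists_germ_eq a
    have h1 := (isUnit_specStalkEval_iff (B := krasner.{u}) q _).2 h
    exact (PrimeMIdeal.isUnit_localizationMk_iff (B := Krasner.{u}) q
      (hx.stalkToKrasner (BandStalk.germ X.presheaf x U hU s)) 1).1 h1
      -- A non-unit germ takes the value `0` in `K`, which lies in every prime.
      ((Krasner.mem_carrier_iff q _).2 ((hx.stalkToKrasner_eq_zero_iff _).2 ha))

/-! ### Image and injectivity of the characteristic map -/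

theorem isKPoint_characteristicMap (X : BandSpace.{u}) (α : RationalPoints krasner.{u} X) :
    IsKPoint X (characteristicMap X α) :=
  IsKPoint.map (X := BandSpec krasner.{u}) α
    ((isKPoint_spec_iff (B := krasner.{u}) _).2 Krasner.isKIdeal_zeroIdeal)

theorem characteristicMap_injective (X : BandSpace.{u}) :
    Function.Injective (characteristicMap X) := fun α β h => by
  refine krasnerPoint_ext fun q => ?_
  obtain rfl : q = Krasner.zeroIdeal := Krasner.eq_zeroIdeal q
  exact h

/-! ## The fine topology -/

/-- Being `1` in `K` means being a unit, and this is tested on the germ of `c` at the image point.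
It identifies that point with the zero set of the associated map from `C` to `K`. -/
theorem globalMap_eq_one_iff {C : BandCat.{u}} (α : RationalPoints krasner.{u} (BandSpec C))
    (c : C) : α.globalMap c = 1 ↔
      c ∉ (show PrimeMIdeal C from characteristicMap (BandSpec C) α).carrier := by
  have h1 := isUnit_pullbackSections_iff (X := BandSpec C) α ⊤ (globalSectionsEquiv C c)
    Krasner.zeroIdeal trivial
  have h2 : IsUnit (BandStalk.germ (BandSpec C).presheaf (characteristicMap (BandSpec C) α) ⊤
      trivial (globalSectionsEquiv C c)) ↔ _ :=
    isUnit_toSpecStalk_iff (characteristicMap (BandSpec C) α) c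
  refine Iff.trans ?_ (h1.trans h2)
  have h3 : globalSectionsEquiv krasner.{u} (α.globalMap c) =
      pullbackSections (BandSpace.Hom.toHom α) ⊤ (globalSectionsEquiv C c) :=
    Equiv.apply_symm_apply _ _
  have h4 : IsUnit (Localization.mk (α.globalMap c) (1 : Krasner.zeroIdeal.{u}.compl)) ↔
      IsUnit ((show SpecSections krasner.{u} ⊤ from
        pullbackSections (BandSpace.Hom.toHom α) ⊤ (globalSectionsEquiv C c)).1
          ⟨Krasner.zeroIdeal, trivial⟩) := by
    rw [← h3]
    rfl
  refine Iff.trans ?_ h4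
  rw [PrimeMIdeal.isUnit_localizationMk_iff, Krasner.mem_carrier_iff]
  rcases Krasner.eq_zero_or_eq_one (α.globalMap c) with h | h <;> rw [h]
  · exact iff_of_false nofun (fun h => h rfl)
  · exact iff_of_true rfl nofun

/-- The preimage of `U_c` under `χ` is the set of `α` with value `1` at `c`. Such sets generate the
affine topology, since `{1}` generates the topology of `K` and `C` is discrete. -/
theorem affineTopology_krasner (C : BandCat.{u}) : affineTopology krasner.{u} C =
    TopologicalSpace.induced (characteristicMap (BandSpec C)) inferInstance := by
  let _ : TopologicalSpace C := ⊥
  have : DiscreteTopology C := ⟨rfl⟩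
  refine le_antisymm ?_ ?_
  · let _ := affineTopology krasner.{u} C
    refine continuous_iff_le_induced.1 (continuous_generateFrom_iff.2 ?_)
    rintro _ ⟨c, rfl⟩
    have e : characteristicMap (BandSpec C) ⁻¹' PrimeMIdeal.principalOpen c =
        (fun α => (⟨α.globalMap, continuous_of_discreteTopology⟩ : C(C, krasner.{u}))) ⁻¹'
          ((fun f : C(C, krasner.{u}) => f c) ⁻¹' {1}) :=
      Set.ext fun α => (globalMap_eq_one_iff α c).symm
    rw [e]
    have h1 : IsOpen ({1} : Set krasner.{u}) := TopologicalSpace.isOpen_generateFrom_of_mem rfl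
    exact isOpen_induced (h1.preimage (continuous_eval_const c))
  · let _ : TopologicalSpace (RationalPoints krasner.{u} (BandSpec C)) :=
      TopologicalSpace.induced (characteristicMap (BandSpec C)) inferInstance
    -- Joint continuity suffices, and since `C` is discrete it reduces to continuity of the
    -- evaluation at each fixed `c`.
    refine continuous_iff_le_induced.1 (ContinuousMap.continuous_of_continuous_uncurry _ ?_)
    rw [continuous_prod_of_discrete_right]
    intro c
    refine continuous_generateFrom_iff.2 ?_
    rintro _ rfl
    exact ⟨PrimeMIdeal.principalOpen c, PrimeMIdeal.isOpen_principalOpen c,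
      Set.ext fun α => (globalMap_eq_one_iff α c).symm⟩

theorem Hom.continuous {X Y : BandSpace.{u}} (f : X ⟶ Y) : Continuous (Hom.toFun f) :=
  (Hom.toHom f).hom.base.hom.continuous

/-- Openness in a supremum of coinduced topologies is tested on each affine source, where the
topology comes from the spectrum. The set `V` is constrained only at the images of rational points.
-/
theorem isOpen_fine_iff {X : BandSpace.{u}} (W : Set (RationalPoints krasner.{u} X)) :
    IsOpen W ↔ ∀ (C : BandCat.{u}) (f : BandSpec C ⟶ X), ∃ V : Set (BandSpec C), IsOpen V ∧
      ∀ α : RationalPoints krasner.{u} (BandSpec C),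
        characteristicMap (BandSpec C) α ∈ V ↔ (α ≫ f : BandSpec krasner.{u} ⟶ X) ∈ W := by
  refine isOpen_iSup_iff.trans (forall_congr' fun C => isOpen_iSup_iff.trans
    (forall_congr' fun f => isOpen_coinduced.trans ?_))
  rw [affineTopology_krasner, isOpen_induced_iff]
  exact exists_congr fun V => and_congr Iff.rfl Set.ext_iff

theorem continuous_characteristicMap (X : BandSpace.{u}) : Continuous (characteristicMap X) :=
  ⟨fun V hV => (isOpen_fine_iff _).2 fun _ f =>
    ⟨Hom.toFun f ⁻¹' V, hV.preimage (Hom.continuous f), fun _ => Iff.rfl⟩⟩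

/-- These are the properties of an affine chart that the openness of `χ` rests on: `V` can be pushed
forward, and points of the kernel space lift to `k`-points of the chart. -/
theorem BandScheme.exists_openMap (X : BandScheme.{u}) (x : X) :
    ∃ (B : BandCat.{u}) (f : BandSpec B ⟶ X.toBandSpace), x ∈ Set.range (Hom.toFun f) ∧
      IsOpenMap (Hom.toFun f) ∧
      ∀ v : BandSpec B, IsKPoint X.toBandSpace (Hom.toFun f v) → IsKPoint (BandSpec B) v := by
  obtain ⟨U, hx, B, ⟨e⟩⟩ := X.exists_affine x
  refine ⟨B, e.inv ≫ ι X.toBandSpace U, ⟨Hom.toFun e.hom ⟨x, hx⟩, ?_⟩, ?_, fun v hv => ?_⟩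
  · exact congrArg (Hom.toFun (ι X.toBandSpace U)) (hom_inv_toFun e _)
  · have h1 : IsOpenMap (Hom.toFun e.inv) := IsOpenMap.of_inverse (Hom.continuous e.hom)
      (hom_inv_toFun e) (inv_hom_toFun e)
    exact U.isOpen.isOpenMap_subtype_val.comp h1
  · have h1 := (IsKPoint.restrict X.toBandSpace U (x := Hom.toFun e.inv v) hv).map e.hom
    rwa [inv_hom_toFun] at h1

theorem isHomeomorph_characteristicMap (X : BandScheme.{u})
    (h : ∀ α : RationalPoints krasner.{u} X.toBandSpace,
      characteristicMap X.toBandSpace α ∈ X.kernelSpace) :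
    IsHomeomorph (fun α : RationalPoints krasner.{u} X.toBandSpace =>
      (⟨characteristicMap X.toBandSpace α, h α⟩ : X.kernelSpace)) where
  continuous := (continuous_characteristicMap X.toBandSpace).subtype_mk h
  isOpenMap W hW := by
    rw [isOpen_iff_forall_mem_open]
    rintro _ ⟨α, hα, rfl⟩
    obtain ⟨B, f, ⟨v, hv⟩, hf, hk⟩ := BandScheme.exists_openMap X (characteristicMap _ α)
    obtain ⟨V, hV, hVW⟩ := (isOpen_fine_iff W).1 hW B f
    -- A lift `v` of the support of `β` is a `k`-point, hence supports a rational point of the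
    -- chart. Its composite with `f` has the same support as `β`, so it is `β` by injectivity of
    -- `χ`.
    have key : ∀ (v : BandSpec B) (β : RationalPoints krasner.{u} X.toBandSpace),
        Hom.toFun f v = characteristicMap _ β → (v ∈ V ↔ β ∈ W) := by
      intro v β hvβ
      have hv : IsKPoint (BandSpec B) v := hk v (hvβ ▸ isKPoint_characteristicMap _ β)
      have e : (hv.toHom ≫ f : BandSpec krasner.{u} ⟶ X.toBandSpace) = β :=
        characteristicMap_injective _ hvβ
      rw [← e]
      exact hVW hv.toHom
    -- The trace of `f(V)` on the kernel space is an open neighbourhood of `χ(α)`; by `key`, all its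
    -- points support rational points in `W`.
    refine ⟨Subtype.val ⁻¹' (Hom.toFun f '' V), ?_, (hf V hV).preimage continuous_subtype_val,
      v, (key v α hv).2 hα, hv⟩
    rintro ⟨y, hy⟩ ⟨w, hw, hwy⟩
    have hy' := (mem_kernelSpace_iff X y).1 hy
    exact ⟨hy'.toHom, (key w hy'.toHom hwy).1 hw, rfl⟩
  bijective := ⟨fun α β e => characteristicMap_injective _ (congrArg Subtype.val e),
    fun y => ⟨((mem_kernelSpace_iff X y.1).1 y.2).toHom, rfl⟩⟩

/-! ## Spectra are band schemes -/

/-- With `f = 𝟙 X` only as a propositional equality, the two sides of the comparison live over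
different open sets, and the restriction bridges them. It is needed for `e.inv ≫ e.hom`. -/
theorem pullbackSections_eq_res {X : AlgebraicGeometry.SheafedSpace.{u + 1, u, u} BandCat.{u}}
    {f : X ⟶ X} (hf : f = 𝟙 X) (U : Opens X.carrier) (s : X.presheaf.obj (op U))
    (h : (Opens.map f.hom.base).obj U ≤ U) :
    pullbackSections f U s = BandStalk.res X.presheaf h s := by
  subst hf
  exact (BandStalk.res_self X.presheaf s).symm

/-- Isomorphisms of sheafed spaces are automatically local: a local inverse of the pulled back
section, transported along `e.inv`, inverts the original section. -/
theorem isUnit_of_isUnit_stalkMap {X Y : AlgebraicGeometry.SheafedSpace.{u + 1, u, u} BandCat.{u}}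
    (e : X ≅ Y) (x : X.carrier) (a : BandStalk Y.presheaf (e.hom.hom.base x))
    (ha : IsUnit (stalkMap e.hom x a)) : IsUnit a := by
  obtain ⟨U, hU, s, rfl⟩ := BandStalk.exists_germ_eq a
  obtain ⟨V, hV, h, t, hst⟩ := (BandStalk.isUnit_germ_iff (F := X.presheaf)
    (U := (Opens.map e.hom.hom.base).obj U) hU _).1 ha
  have hx : ∀ x, e.inv.hom.base (e.hom.hom.base x) = x := fun x =>
    congrArg (fun f : X ⟶ X => f.hom.base x) e.hom_inv_id
  have hy : ∀ y, e.hom.hom.base (e.inv.hom.base y) = y := fun y =>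
    congrArg (fun f : Y ⟶ Y => f.hom.base y) e.inv_hom_id
  have hU' : (Opens.map (e.inv ≫ e.hom).hom.base).obj U ≤ U := fun y hyU => by
    have : e.hom.hom.base (e.inv.hom.base y) ∈ U := hyU
    rwa [hy] at this
  have hV' : (Opens.map e.inv.hom.base).obj V ≤ (Opens.map (e.inv ≫ e.hom).hom.base).obj U :=
    fun y hyV => h hyV
  refine (BandStalk.isUnit_germ_iff hU s).2 ⟨(Opens.map e.inv.hom.base).obj V, ?_,
    hV'.trans hU', pullbackSections e.inv V t, ?_⟩
  · change e.inv.hom.base (e.hom.hom.base x) ∈ V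
    rwa [hx]
  · rw [← BandStalk.res_res hU' hV', ← pullbackSections_eq_res e.inv_hom_id U s hU']
    have h1 := congrArg (pullbackSections e.inv V) hst
    rw [map_mul, map_one, pullbackSections_res e.inv h hV'] at h1
    exact h1

/-- A band space is isomorphic to its restriction to the whole space. -/
def restrictTopIso (X : BandSpace.{u}) : X.restrict ⊤ ≅ X where
  hom := ι X ⊤
  inv := ⟨X.toSheafedSpace.restrictTopIso.inv, fun x a ha h =>
    ha (isUnit_of_isUnit_stalkMap X.toSheafedSpace.restrictTopIso.symm x a h)⟩
  hom_inv_id := Hom.ext X.toSheafedSpace.restrictTopIso.hom_inv_id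
  inv_hom_id := Hom.ext X.toSheafedSpace.restrictTopIso.inv_hom_id

end BandSpace

/-- The spectrum of a band as a band scheme. -/
def BandScheme.spec (B : BandCat.{u}) : BandScheme.{u} where
  toBandSpace := BandSpec B
  exists_affine _ := ⟨⊤, trivial, B, ⟨BandSpace.restrictTopIso (BandSpec B)⟩⟩

namespace BandSpace

theorem exists_isKPoint (Y : BandScheme.{u}) (y : Y) : ∃ z : Y, IsKPoint Y.toBandSpace z := by
  obtain ⟨U, hy, B, ⟨e⟩⟩ := Y.exists_affine y
  let p : PrimeMIdeal B := Hom.toFun e.hom ⟨y, hy⟩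
  -- The point `y` serves only to show `0 ≠ 1` in the coordinate band of a chart; the `k`-point
  -- obtained may be a different one.
  obtain ⟨q, hq⟩ := exists_prime_isKIdeal B fun h => p.one_notMem (h ▸ p.zero_mem)
  exact ⟨_, (((isKPoint_spec_iff q).2 hq).map e.inv).map (ι Y.toBandSpace U)⟩

end BandSpace

/-- The characteristic map `X(K) → X` restricts to a homeomorphism from the set of `K`-rational
points, with the fine topology that is induced by the natural topology of `K`, onto the kernel
space of the band scheme `X`, and the points of the kernel space are characterized by images of
morphisms and by residue fields. -/
theorem mainTheorem11 (X : BandScheme.{u}) :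
    (∃ h : ∀ α : RationalPoints krasner.{u} X.toBandSpace,
        characteristicMap X.toBandSpace α ∈ X.kernelSpace,
      IsHomeomorph (fun α : RationalPoints krasner.{u} X.toBandSpace =>
        (⟨characteristicMap X.toBandSpace α, h α⟩ : X.kernelSpace))) ∧
    ∀ x : X, List.TFAE
      [x ∈ X.kernelSpace,
        ∃ (Y : BandScheme.{u}) (φ : Y.toBandSpace ⟶ X.toBandSpace),
          Set.range (BandSpace.Hom.toFun φ) = {x},
        IsIdyll (X.residueField x),
        Nontrivial (X.residueField x)] := by
  refine ⟨⟨fun α => (BandSpace.mem_kernelSpace_iff X _).2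
    (BandSpace.isKPoint_characteristicMap X.toBandSpace α),
    BandSpace.isHomeomorph_characteristicMap X _⟩, fun x => ?_⟩
  rw [BandSpace.mem_kernelSpace_iff]
  tfae_have 1 → 2 := fun h => ⟨BandScheme.spec krasner.{u}, h.toHom, by
    ext y
    exact ⟨by rintro ⟨q, rfl⟩; rfl,
      fun hy => ⟨Krasner.zeroIdeal, (Set.mem_singleton_iff.1 hy).symm⟩⟩⟩
  tfae_have 2 → 1 := by
    rintro ⟨Y, φ, h⟩
    obtain ⟨y, -⟩ : x ∈ Set.range (BandSpace.Hom.toFun φ) := by rw [h]; rfl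
    obtain ⟨z, hz⟩ := BandSpace.exists_isKPoint Y y
    -- As the image is the single point `x`, any `k`-point `z` of `Y` maps to `x`.
    have hzx : BandSpace.Hom.toFun φ z ∈ ({x} : Set X) := h ▸ ⟨z, rfl⟩
    exact Set.mem_singleton_iff.1 hzx ▸ hz.map φ
  tfae_have 1 → 3 := isIdyll_residue
  tfae_have 3 → 4 := fun h => ⟨0, 1, h.1⟩
  tfae_have 4 → 1 := isKIdeal_nonunits_of_nontrivial_residue
  tfae_finish
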